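/- **Complexity model.** Let $K$ be a field. Algorithms are algebraic computation trees over $K$: they may apply $+,-,\times,\div$ to input coefficients, constants of $K$ and previously computed values, and may branch on whether a value is zero. Each arithmetic operation and each zero test costs $1$; operations on monomials are not counted (the tree may depend on $n$, $M$, $\mu$), and a division by zero is never executed on an admissible input. A real number $\omega$ is a *feasible exponent for matrix multiplication over $K$*, with constant $c$, if for every $n$ two $n\times n$ matrices over $K$ can be multiplied within $c\,n^{\omega}$ operations. **Statement.** Let $k\ge 0$ be an integer and let $\omega>2$ and $c$ be real numbers. There is a constant $C$, depending only on $k$, $\omega$ and $c$, such that the following holds for every field $K$ over which $\omega$ is a feasible exponent for matrix multiplication with constant $c$, and for every $n>2k$. Let $M$ be a set of $n+k+1$ monomials of degree at most $2$ in $X_1,\dots,X_n$ which contains $1$ and all the squares $X_1^2,\dots,X_n^2$, and let $\mu\in M$ be a square-free monomial. Let $\ell$ be the number of variables that appear in some square-free monomial of $M$. Then there is an algorithm whose input consists of the coefficients of polynomials $f_1,\dots,f_n\in K[X_1,\dots,X_n]$ with all their monomials in $M$, and which has the following property. Suppose that $f_1=\dots=f_n=0$ has finitely many solutions in $\overline K^{\,n}$,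 and that the $n\times(n-\ell)$ matrix $S$ has full rank $n-\ell$, where $S$ consists of the coefficients in $f_1,\dots,f_n$ of the squares $X_i^2$ of those variables $X_i$ that appear in no square-free monomial of $M$. Then the algorithm computes, within at most $C\,n^{\omega}$ operations, the coefficients of a nonzero univariate polynomial $P\in K[T]$ such that $P(\mu(a))=0$ for every solution $a\in\overline K^{\,n}$ of $f_1=\dots=f_n=0$. -/

import Mathlib

universe u

/-! ### Arithmetic programs over a field

The complexity model: algebraic computation trees. A program may apply `+, -, *, /` to inputs,
constants of the field and previously computed values, and may branch on whether a value is zero.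
Every arithmetic operation and every zero test has unit cost; nothing else is counted. -/

/-- The four arithmetic operations. -/
inductive ArithOp : Type
  | add
  | sub
  | mul
  | div

open Classical in
/-- The result of an arithmetic operation; division by zero has no result. -/
noncomputable def ArithOp.eval {K : Type u} [Field K] : ArithOp → K → K → Option K
  | .add, a, b => some (a + b)
  | .sub, a, b => some (a - b)
  | .mul, a, b => some (a * b)
  | .div, a, b => if b = 0 then none else some (a / b)

/-- What an instruction can read: a constant of `K`, one of the inputs (indexed by `ι`), or a
register holding a computed value. -/
inductive Operand (K : Type u) (ι : Type) : Type u
  | const (a : K)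
  | input (i : ι)
  | reg (r : ℕ)

/-- The value of an operand on the input `x`, when the registers contain `m`. -/
def Operand.eval {K : Type u} {ι : Type} (x : ι → K) (m : ℕ → K) : Operand K ι → K
  | .const a => a
  | .input i => x i
  | .reg r => m r

/-- Algebraic computation trees over `K`, with inputs indexed by `ι` and outputs indexed by `κ`. -/
inductive ArithProgram (K : Type u) (ι κ : Type) : Type u
  /-- Stop and return the given values. -/
  | output (out : κ → Operand K ι)
  /-- Write the result of an arithmetic operation to the register `dst`, then continue. -/
  | compute (op : ArithOp) (a b : Operand K ι) (dst : ℕ) (next : ArithProgram K ι κ)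
  /-- Continue with `yes` if the value of `a` is zero, and with `no` otherwise. -/
  | ifZero (a : Operand K ι) (yes no : ArithProgram K ι κ)

open Classical in
/-- Execution on the input `x` with register contents `m`: the output values, together with the
number of arithmetic operations and zero tests that were executed. The execution fails (`none`)
if it divides by zero. -/
noncomputable def ArithProgram.execFrom {K : Type u} [Field K] {ι κ : Type} (x : ι → K) :
    ArithProgram K ι κ → (ℕ → K) → Option ((κ → K) × ℕ)
  | .output out, m => some (fun j => (out j).eval x m, 0)
  | .compute op a b dst next, m =>
      (op.eval (a.eval x m) (b.eval x m)).bind fun v =>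
        (next.execFrom x (Function.update m dst v)).map fun r => (r.1, r.2 + 1)
  | .ifZero a yes no, m =>
      (if a.eval x m = 0 then yes.execFrom x m else no.execFrom x m).map fun r => (r.1, r.2 + 1)

/-- Execution of a program on the input `x`; all registers initially contain `0`. -/
noncomputable def ArithProgram.exec {K : Type u} [Field K] {ι κ : Type}
    (p : ArithProgram K ι κ) (x : ι → K) : Option ((κ → K) × ℕ) :=
  p.execFrom x fun _ => 0

/-- Two `n × n` matrices over `K` can be multiplied within `c * n ^ ω` operations, for every `n`.
The real number `ω` is a feasible exponent for matrix multiplication over `K` if this holds for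
some `c`. -/
def MatMulCostBound (K : Type u) [Field K] (ω c : ℝ) : Prop :=
  ∀ n : ℕ, ∃ p : ArithProgram K ((Fin n × Fin n) ⊕ (Fin n × Fin n)) (Fin n × Fin n),
    ∀ A B : Matrix (Fin n) (Fin n) K, ∃ t : ℕ,
      p.exec (Sum.elim (fun ij => A ij.1 ij.2) (fun ij => B ij.1 ij.2)) =
          some (fun ij => (A * B) ij.1 ij.2, t) ∧
        (t : ℝ) ≤ c * (n : ℝ) ^ ω

/-! ### Quadratic supports containing all the squares

A monomial `X ^ α` in `n` variables is represented by its exponent vector `α : Fin n →₀ ℕ`. -/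

/-- No variable has exponent at least two. -/
def IsSquareFreeMonomial {n : ℕ} (α : Fin n →₀ ℕ) : Prop :=
  ∀ i, α i ≤ 1

/-- `M` is a set of `n + k + 1` monomials of degree at most two in `n` variables, which contains
the constant monomial `1` and the squares of all the variables. -/
structure IsAllSquaresSupport {n : ℕ} (k : ℕ) (M : Finset (Fin n →₀ ℕ)) : Prop where
  degree_le : ∀ α ∈ M, α.degree ≤ 2
  one_mem : 0 ∈ M
  square_mem : ∀ i, Finsupp.single i 2 ∈ M
  card_eq : M.card = n + k + 1

open Classical in
/-- The (indices of the) variables that appear in no square-free monomial of `M`. Their number is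
`n - ℓ`, where `ℓ` is the number of variables that appear in some square-free monomial of `M`. -/
noncomputable def isolatedVars {n : ℕ} (M : Finset (Fin n →₀ ℕ)) : Finset (Fin n) :=
  Finset.univ.filter fun i => ∀ α ∈ M, IsSquareFreeMonomial α → α i = 0

/-- The `n × (n - ℓ)` matrix `S` of the coefficients in `f 0, …, f (n-1)` of the squares of the
variables that appear in no square-free monomial of `M`. -/
noncomputable def isolatedSquareMatrix {K : Type u} [Field K] {n : ℕ} (M : Finset (Fin n →₀ ℕ))
    (f : Fin n → MvPolynomial (Fin n) K) : Matrix (Fin n) (isolatedVars M) K :=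
  Matrix.of fun i j => (f i).coeff (Finsupp.single (j : Fin n) 2)

/-- The solutions of `f = 0` with coordinates in the algebraic closure of `K`. -/
def solutionSet {K : Type u} [Field K] {n : ℕ} (f : Fin n → MvPolynomial (Fin n) K) :
    Set (Fin n → AlgebraicClosure K) :=
  {a | ∀ i, MvPolynomial.aeval a (f i) = 0}

/-- `P` is a nonzero univariate polynomial such that `P(μ)` vanishes at all the solutions of the
system `f = 0` in the algebraic closure. -/
def VanishesOnSolutions {K : Type u} [Field K] {n : ℕ} (f : Fin n → MvPolynomial (Fin n) K)
    (μ : Fin n →₀ ℕ) (P : Polynomial K) : Prop :=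
  P ≠ 0 ∧ ∀ a ∈ solutionSet f, Polynomial.aeval (∏ i, a i ^ μ i) P = 0

/-- The univariate polynomial with the given coefficients, by increasing degree. -/
noncomputable def polyOfCoeffs {K : Type u} [Field K] {d : ℕ} (y : Fin d → K) : Polynomial K :=
  ∑ j : Fin d, Polynomial.monomial (j : ℕ) (y j)

/-!
The solutions are computed by eliminating the isolated variables with fast linear algebra; what is
left is a system whose size is bounded in terms of `k` only.

*Reduction to bounded size.* Write `S` for the matrix of the coefficients of the isolated squares.
As `S` has full column rank `n - ℓ`, its left kernel has dimension `ℓ`. The combinations of the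
equations with a basis of the left kernel are `ℓ` equations in the `ℓ ≤ 2 * k` variables that appear
in square-free monomials. Each of their zeros extends to a solution of the original system
(`exists_mem_solutionSet_of_isKernelBasis`): the squares of the isolated variables solve a linear
system, and square roots exist in the algebraic closure. So the reduced system has finitely many
zeros, too, and `μ` involves only its variables.

*Kernels in time `O(n ^ ω)`.* The kernel is read off from a reduced row echelon form
(`IsReducedForm.isKernelBasis`). This is computed by recursion on the two halves of the rows; either
half is cleared of the pivots of the other one by a matrix product
(`IsReducedForm.fromRows`). As `ω > 2`, the cost is dominated by a geometric sum
(`Fragment.rowReduceCost_le`, `exists_fragment_kernelBasis`).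

*Systems of bounded size.* Let `g = μ` and let `h 1, …, h ℓ` be the reduced system. Counting
monomials gives a nonzero `Q(T, Y)` of bounded degree with `Q(g, h) = 0`, whose coefficients are
found as a vector in the kernel of a matrix of bounded size. It may happen that `Q(T, 0) = 0`, but
the form of lowest degree in `Y` of `Q` has coefficients in `K[T]`, and all of them vanish at the
values of `g` at the zeros of `h` (`eval_coeff_eq_zero_of_relation`): by Krull's height theorem, a
curve passes through every isolated zero on which `h` is a multiple of a given direction. Any
nonzero coefficient can therefore be returned (`exists_fragment_eliminant`).

*Programs.* Algorithms are written as `Fragment`s, programs in continuation-passing style, and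
their correctness and cost are stated by `Fragment.Runs`. The outcomes of zero tests, such as the
positions of pivots, are ordinary data on which the rest of the program may depend, so that only
arithmetic operations and zero tests are counted. -/

/-! ### Isolated zeros and polynomial relations -/

section Geometry

open MvPolynomial

/-- The maximal ideal of a point of affine space over an algebraically closed field has height at
least the number of variables. The automorphism translating one point to another reduces this to
the existence of a maximal ideal whose height is the dimension. -/
theorem card_le_height_vanishingIdeal_singleton {F σ : Type*} [Field F] [IsAlgClosed F] [Fintype σ]
    (b : σ → F) : (Fintype.card σ : ℕ∞) ≤ (vanishingIdeal F {b}).height := by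
  have hdim : ringKrullDim (MvPolynomial σ F) = (Fintype.card σ : ℕ∞) := by
    rw [MvPolynomial.ringKrullDim_of_isNoetherianRing, ringKrullDim_eq_zero_of_field]
    simp
  have hfin : FiniteRingKrullDim (MvPolynomial σ F) := by
    rw [finiteRingKrullDim_iff_ne_bot_and_top, hdim]
    exact ⟨by simp, fun h => by
      have := WithBot.coe_injective (a₁ := ((Fintype.card σ : ℕ) : ℕ∞)) (a₂ := ⊤) h
      simp at this⟩
  obtain ⟨p, hp, hph⟩ := Ideal.exists_isMaximal_height (R := MvPolynomial σ F)
  obtain ⟨c, rfl⟩ := eq_vanishingIdeal_singleton_of_isMaximal F hp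
  rw [hdim] at hph
  have hph' : (vanishingIdeal F {c}).height = Fintype.card σ := WithBot.coe_injective hph
  let tr : (σ → F) → MvPolynomial σ F →ₐ[F] MvPolynomial σ F := fun d => aeval fun i => X i + C (d i)
  have htr : ∀ d e, d + e = 0 → (tr d).comp (tr e) = AlgHom.id F _ := by
    intro d e hde
    ext i
    have : d i + e i = 0 := congrFun hde i
    simp only [tr, AlgHom.comp_apply, aeval_X, map_add, AlgHom.id_apply]
    rw [show aeval (fun i => X i + C (d i)) (C (e i)) = (C (e i) : MvPolynomial σ F) from aeval_C _ _,
      add_assoc, ← C_add, this, C_0, add_zero]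
  let e : MvPolynomial σ F ≃ₐ[F] MvPolynomial σ F :=
    AlgEquiv.ofAlgHom (tr (c - b)) (tr (b - c)) (htr _ _ (by abel)) (htr _ _ (by abel))
  have hcomap : (vanishingIdeal F {b}).comap (e : MvPolynomial σ F ≃+* MvPolynomial σ F)
      = vanishingIdeal F {c} := by
    ext q
    have : (aeval b).comp (tr (c - b)) = (aeval c : MvPolynomial σ F →ₐ[F] F) := by
      ext i
      simp [tr]
    have h2 : aeval b (e q) = aeval c q := by
      rw [← this]; rfl
    rw [Ideal.mem_comap, mem_vanishingIdeal_singleton_iff, mem_vanishingIdeal_singleton_iff, ← h2]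
    rfl
  have := (e : MvPolynomial σ F ≃+* MvPolynomial σ F).height_comap (vanishingIdeal F {b})
  rw [hcomap, hph'] at this
  exact this.le

/-- Over an algebraically closed field, a prime with finitely many zeros that lies in the maximal
ideal of a point is that maximal ideal. -/
theorem eq_vanishingIdeal_singleton_of_finite_zeroLocus {F σ : Type*} [Field F] [IsAlgClosed F]
    [Finite σ] (p : Ideal (MvPolynomial σ F)) [hp : p.IsPrime] (hfin : (zeroLocus F p).Finite)
    {b : σ → F} (hb : p ≤ vanishingIdeal F {b}) : p = vanishingIdeal F {b} := by
  have h1 : hfin.toFinset.inf (fun c => vanishingIdeal F {c}) ≤ p := by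
    intro q hq
    rw [← IsPrime.vanishingIdeal_zeroLocus (K := F) p]
    intro x hx
    have := (Finset.inf_le (f := fun c => vanishingIdeal F {c})
      (hfin.mem_toFinset.2 hx)) hq
    exact (mem_vanishingIdeal_singleton_iff _ _).1 this
  obtain ⟨c, -, hc⟩ := (Ideal.IsPrime.inf_le' hp).1 h1
  have : (vanishingIdeal F {c} : Ideal (MvPolynomial σ F)).IsMaximal := inferInstance
  have h2 := this.eq_of_le (hp.ne_top) hc
  rw [← h2] at hb ⊢
  exact this.eq_of_le (Ideal.IsPrime.ne_top inferInstance) hb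

/-- Let `h` be as many polynomials as there are variables, with finitely many common zeros, and let
`Q` be a relation between the `h i` with coefficients that are polynomials in `g`. At every common
zero of `h`, the coefficients of the lowest homogeneous form of `Q` vanish.

Otherwise the form has a nonzero value at some direction `v`. By Krull's height theorem the
inverse image under `h` of the line through `0` in direction `v` contains a curve through the zero
`b`, and on this curve `h = s • v` for a function `s` which is not identically `0`. Dividing the
relation by the lowest power of `s` and evaluating at `b` gives a contradiction. -/
theorem eval_coeff_eq_zero_of_relation {F σ : Type*} [Field F] [IsAlgClosed F] [Fintype σ]
    (h : σ → MvPolynomial σ F) (g : MvPolynomial σ F) (hfin : {b | ∀ i, eval b (h i) = 0}.Finite)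
    (Q : MvPolynomial σ (Polynomial F))
    (hQ : eval₂ (Polynomial.aeval g : Polynomial F →ₐ[F] MvPolynomial σ F).toRingHom h Q = 0)
    (β : σ →₀ ℕ) (hβ : ∀ γ ∈ Q.support, β.degree ≤ γ.degree)
    (b : σ → F) (hb : ∀ i, eval b (h i) = 0) :
    (Q.coeff β).eval (eval b g) = 0 := by
  classical
  by_contra hne
  set m := β.degree with hm
  have haev : ∀ (x : σ → F) (P : MvPolynomial σ F), aeval x P = eval x P := fun x P => by
    rw [← coe_aeval_eq_eval]; rfl
  let q : MvPolynomial σ F :=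
    homogeneousComponent m (MvPolynomial.map (Polynomial.evalRingHom (eval b g)) Q)
  have hq : q ≠ 0 := by
    intro h0
    have : coeff β q = 0 := by rw [h0, coeff_zero]
    rw [coeff_homogeneousComponent, if_pos hm.symm, coeff_map] at this
    exact hne this
  obtain ⟨v, hv⟩ : ∃ v, eval v q ≠ 0 := by
    by_contra hall
    push Not at hall
    exact hq (MvPolynomial.funext fun x => by rw [hall x, map_zero])
  -- the relation, expanded
  have hrel : ∑ γ ∈ Q.support, Polynomial.aeval g (Q.coeff γ) * ∏ i, h i ^ γ i = 0 := by
    rw [← hQ, eval₂_eq']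
    rfl
  have hevalg : ∀ P : Polynomial F, eval b (Polynomial.aeval g P) = P.eval (eval b g) := by
    intro P
    have := Polynomial.aeval_algHom_apply (aeval b : MvPolynomial σ F →ₐ[F] F) g P
    rw [haev, haev] at this
    rw [← this, Polynomial.coe_aeval_eq_eval]
  have hqv : eval v q = ∑ γ ∈ Q.support with γ.degree = m,
      (Q.coeff γ).eval (eval b g) * ∏ i, v i ^ γ i := by
    have h1 : q = ∑ γ ∈ Q.support with γ.degree = m,
        monomial γ ((Q.coeff γ).eval (eval b g)) := by
      ext γ
      simp only [q, coeff_homogeneousComponent, coeff_map, coeff_sum, coeff_monomial]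
      rw [Finset.sum_ite_eq']
      simp only [Finset.mem_filter, mem_support_iff]
      by_cases h0 : coeff γ Q = 0
      · simp [h0]
      · simp [h0]
    rw [h1, map_sum]
    refine Finset.sum_congr rfl fun γ _ => ?_
    rw [eval_monomial, Finsupp.prod_fintype _ _ (fun i => pow_zero _)]
  by_cases hv0 : v = 0
  · -- the form has degree zero: evaluate the relation at `b`
    have hm0 : m = 0 := by
      by_contra hm0
      apply hv
      rw [hqv]
      refine Finset.sum_eq_zero fun γ hγ => ?_
      have hγm := (Finset.mem_filter.1 hγ).2
      have : γ ≠ 0 := by rintro rfl; simp at hγm; exact hm0 hγm.symm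
      obtain ⟨i, hi⟩ := Finsupp.ne_iff.1 this
      rw [Finset.prod_eq_zero (Finset.mem_univ i), mul_zero]
      rw [hv0]; exact zero_pow hi
    have hβ0 : β = 0 := by
      rw [← Finsupp.degree_eq_zero_iff]; exact hm ▸ hm0
    have := congrArg (eval b) hrel
    rw [map_sum, map_zero] at this
    rw [Finset.sum_eq_single 0] at this
    · apply hne
      rw [hβ0, ← hevalg]
      simpa using this
    · intro γ _ hγ
      obtain ⟨i, hi⟩ := Finsupp.ne_iff.1 hγ
      rw [map_mul, map_prod, Finset.prod_eq_zero (Finset.mem_univ i), mul_zero]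
      rw [map_pow, hb i]; exact zero_pow hi
    · intro h0
      rw [notMem_support_iff.1 h0]; simp
  obtain ⟨j, hj⟩ := Function.ne_iff.1 hv0
  have hj : v j ≠ 0 := hj
  let s : MvPolynomial σ F := C (v j)⁻¹ * h j
  let gens : Finset (MvPolynomial σ F) :=
    (Finset.univ.erase j).image fun i => h i - C (v i) * s
  have hs : h j = C (v j) * s := by
    rw [← mul_assoc, ← C_mul, mul_inv_cancel₀ hj, C_1, one_mul]
  have hsb : eval b s = 0 := by simp [s, hb]
  have hle : Ideal.span (gens : Set (MvPolynomial σ F)) ≤ vanishingIdeal F {b} := by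
    rw [Ideal.span_le]
    intro f hf
    obtain ⟨i, -, rfl⟩ := Finset.mem_image.1 (Finset.mem_coe.1 hf)
    rw [SetLike.mem_coe, mem_vanishingIdeal_singleton_iff, haev]
    simp [hb, hsb]
  obtain ⟨p, hpmin, hpb⟩ := Ideal.exists_minimalPrimes_le hle
  have hp : p.IsPrime := hpmin.1.1
  have hmem : ∀ i, h i - C (v i) * s ∈ p := by
    intro i
    by_cases hij : i = j
    · rw [hij, ← hs, sub_self]; exact p.zero_mem
    · exact hpmin.1.2 (Ideal.subset_span (Finset.mem_coe.2 (Finset.mem_image_of_mem _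
        (Finset.mem_erase.2 ⟨hij, Finset.mem_univ i⟩))))
  have hsp : s ∉ p := by
    intro hsp
    have hall : ∀ i, h i ∈ p := fun i => by
      have := p.add_mem (hmem i) (p.mul_mem_left (C (v i)) hsp)
      simpa using this
    have hz : (zeroLocus F p).Finite := by
      refine hfin.subset fun x hx i => ?_
      have := hx _ (hall i)
      rwa [haev] at this
    have hpe := eq_vanishingIdeal_singleton_of_finite_zeroLocus p hz hpb
    have h1 := Ideal.height_le_card_of_mem_minimalPrimes_span_finset hpmin
    rw [hpe] at h1
    have h2 := (card_le_height_vanishingIdeal_singleton b).trans h1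
    have h3 : Fintype.card σ ≤ gens.card := by exact_mod_cast h2
    have h4 : gens.card ≤ Fintype.card σ - 1 := by
      refine Finset.card_image_le.trans ?_
      rw [Finset.card_erase_of_mem (Finset.mem_univ j)]; rfl
    have h5 : 0 < Fintype.card σ := Fintype.card_pos_iff.2 ⟨j⟩
    omega
  -- modulo `p`, the relation is divisible by `s ^ m`
  let R : MvPolynomial σ F := ∑ γ ∈ Q.support,
    Polynomial.aeval g (Q.coeff γ) * C (∏ i, v i ^ γ i) * s ^ (γ.degree - m)
  have hR : s ^ m * R ∈ p := by
    rw [← Ideal.Quotient.eq_zero_iff_mem, ← map_zero (Ideal.Quotient.mk p), ← hrel]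
    have hmk : ∀ i, Ideal.Quotient.mk p (h i) = Ideal.Quotient.mk p (C (v i) * s) := fun i =>
      Ideal.Quotient.eq.2 (hmem i)
    rw [Finset.mul_sum, map_sum, map_sum]
    refine Finset.sum_congr rfl fun γ hγ => ?_
    simp only [map_mul, map_prod, map_pow, hmk, mul_pow, Finset.prod_mul_distrib]
    rw [Finset.prod_pow_eq_pow_sum, ← Finsupp.degree_eq_sum]
    have hpow : (Ideal.Quotient.mk p s) ^ γ.degree
        = Ideal.Quotient.mk p s ^ m * Ideal.Quotient.mk p s ^ (γ.degree - m) := by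
      rw [← pow_add, Nat.add_sub_cancel' (hβ γ hγ)]
    rw [hpow]
    ring
  have hRp : R ∈ p := (hp.mem_or_mem hR).resolve_left fun h1 => hsp (hp.mem_of_pow_mem _ h1)
  have hRb : eval b R = 0 := by
    have := (mem_vanishingIdeal_singleton_iff _ _).1 (hpb hRp)
    rwa [haev] at this
  apply hv
  rw [hqv, ← hRb, map_sum, Finset.sum_filter]
  refine Finset.sum_congr rfl fun γ hγ => ?_
  rw [map_mul, map_mul, hevalg, eval_C, map_pow, hsb]
  split_ifs with h1
  · rw [h1, Nat.sub_self, pow_zero, mul_one]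
  · have := hβ γ hγ
    rw [zero_pow (by omega), mul_zero]

end Geometry

/-! ### Program fragments and their cost -/

universe v w

/-- A program fragment which computes a result of type `α`, in continuation-passing style: it is
given the first unused register and the rest of the program, which depends on the result and on the
first register that is unused afterwards. Values of `K` that are computed at run time occur in
results only through operands, but the outcome of zero tests may be used freely. -/
def Fragment (K : Type u) (ι κ : Type) (α : Type v) : Type (max u v) :=
  ℕ → (α → ℕ → ArithProgram K ι κ) → ArithProgram K ι κ

/-- The first unused register, together with the contents of all the registers. -/
structure MachineState (K : Type u) : Type u where
  next : ℕ
  mem : ℕ → K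

/-- The state `σ'` is reachable from `σ` without overwriting a register that is in use. -/
def MachineState.Extends {K : Type u} (σ σ' : MachineState K) : Prop :=
  σ.next ≤ σ'.next ∧ ∀ r < σ.next, σ'.mem r = σ.mem r

theorem MachineState.Extends.refl {K : Type u} (σ : MachineState K) : σ.Extends σ :=
  ⟨le_rfl, fun _ _ => rfl⟩

theorem MachineState.Extends.trans {K : Type u} {σ σ' σ'' : MachineState K}
    (h : σ.Extends σ') (h' : σ'.Extends σ'') : σ.Extends σ'' :=
  ⟨h.1.trans h'.1, fun r hr => (h'.2 r (hr.trans_le h.1)).trans (h.2 r hr)⟩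

/-- On the input `x` and in the state `σ`, the operand has the value `v`, and it reads no unused
register. -/
def Operand.Represents {K : Type u} {ι : Type} (x : ι → K) (σ : MachineState K) (o : Operand K ι)
    (v : K) : Prop :=
  (∀ r, o = .reg r → r < σ.next) ∧ o.eval x σ.mem = v

section Represents

variable {K : Type u} {ι : Type} {x : ι → K} {σ σ' : MachineState K}

theorem Operand.Represents.mono {o : Operand K ι} {v : K} (h : o.Represents x σ v)
    (hσ : σ.Extends σ') : o.Represents x σ' v := by
  refine ⟨fun r hr => (h.1 r hr).trans_le hσ.1, ?_⟩
  rw [← h.2]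
  cases o with
  | const a => rfl
  | input i => rfl
  | reg r => exact hσ.2 r (h.1 r rfl)

theorem Operand.represents_const (a : K) : (Operand.const a : Operand K ι).Represents x σ a :=
  ⟨fun _ h => (nomatch h), rfl⟩

theorem Operand.represents_input (i : ι) : (Operand.input i : Operand K ι).Represents x σ (x i) :=
  ⟨fun _ h => (nomatch h), rfl⟩

end Represents

/-- On the input `x` and in the state `σ`, the fragment `c` is executed within `t` operations, and
its result and the state reached satisfy `Q`. -/
def Fragment.Runs {K : Type u} [Field K] {ι κ : Type} {α : Type v} (x : ι → K)
    (c : Fragment K ι κ α) (σ : MachineState K) (t : ℝ) (Q : α → MachineState K → Prop) : Prop :=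
  ∃ (a : α) (σ' : MachineState K) (t' : ℕ), σ.Extends σ' ∧ (t' : ℝ) ≤ t ∧ Q a σ' ∧
    ∀ k, (c σ.next k).execFrom x σ.mem =
      ((k a σ'.next).execFrom x σ'.mem).map fun r => (r.1, r.2 + t')

namespace Fragment

variable {K : Type u} {ι κ : Type} {α : Type v} {β : Type w}

/-- The fragment with result `a` that does nothing. -/
def ret (a : α) : Fragment K ι κ α := fun s k => k a s

/-- Sequential composition. -/
def bind (c : Fragment K ι κ α) (f : α → Fragment K ι κ β) : Fragment K ι κ β :=
  fun s k => c s fun a s' => f a s' k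

/-- An arithmetic operation. -/
def arith (o : ArithOp) (a b : Operand K ι) : Fragment K ι κ (Operand K ι) :=
  fun s k => .compute o a b s (k (.reg s) (s + 1))

/-- A zero test. -/
def testZero (a : Operand K ι) : Fragment K ι κ Bool :=
  fun s k => .ifZero a (k true s) (k false s)

/-- The results of finitely many fragments, which are executed one after the other. -/
def traverseFin : {n : ℕ} → (Fin n → Fragment K ι κ α) → Fragment K ι κ (Fin n → α)
  | 0, _ => ret Fin.elim0
  | _ + 1, f => (f 0).bind fun a => (traverseFin fun i => f i.succ).bind fun g => ret (Fin.cons a g)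

/-- The results of a finite family of fragments, which are executed one after the other. -/
noncomputable def traverse {I : Type*} [Fintype I] (f : I → Fragment K ι κ α) :
    Fragment K ι κ (I → α) :=
  (traverseFin fun i => f ((Fintype.equivFin I).symm i)).bind fun g =>
    ret fun i => g (Fintype.equivFin I i)

/-- The indices of the nonzero values in a finite family. -/
noncomputable def nonzeroSet {I : Type*} [Fintype I] (a : I → Operand K ι) :
    Fragment K ι κ (Finset I) :=
  (traverse fun i => testZero (a i)).bind fun z => ret (Finset.univ.filter fun i => z i = false)

/-- The inner product of two vectors. -/
def innerProduct [Zero K] : {n : ℕ} → (a b : Fin n → Operand K ι) → Fragment K ι κ (Operand K ι)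
  | 0, _, _ => ret (.const 0)
  | _ + 1, a, b => (arith .mul (a 0) (b 0)).bind fun p =>
      (innerProduct (fun i => a i.succ) fun i => b i.succ).bind fun r => arith .add p r

/-- The operand that an operand of a subprogram stands for, when `args` are the inputs of the
subprogram and `ρ` says where the contents of its registers are kept. -/
def substOperand {ι' : Type} (args : ι' → Operand K ι) (ρ : ℕ → Operand K ι) :
    Operand K ι' → Operand K ι
  | .const a => .const a
  | .input i => args i
  | .reg r => ρ r

/-- The program `p`, executed as a part of another program on the inputs `args`. Every value it
computes is written to a fresh register, and `ρ` says which operand currently stands for each of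
the registers of `p`. -/
def inline {ι' κ' : Type} (args : ι' → Operand K ι) :
    ArithProgram K ι' κ' → (ℕ → Operand K ι) → Fragment K ι κ (κ' → Operand K ι)
  | .output out, ρ => ret fun j => substOperand args ρ (out j)
  | .compute op a b dst next, ρ =>
      (arith op (substOperand args ρ a) (substOperand args ρ b)).bind fun r =>
        inline args next (Function.update ρ dst r)
  | .ifZero a yes no, ρ =>
      (testZero (substOperand args ρ a)).bind fun z =>
        if z then inline args yes ρ else inline args no ρ

theorem substOperand_represents {ι' : Type} {args : ι' → Operand K ι} {ρ : ℕ → Operand K ι}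
    {x : ι → K} {σ : MachineState K}
    {y : ι' → K} {m : ℕ → K} (hargs : ∀ i, (args i).Represents x σ (y i))
    (hρ : ∀ r, (ρ r).Represents x σ (m r)) (o : Operand K ι') :
    (substOperand args ρ o).Represents x σ (o.eval y m) := by
  cases o with
  | const a => exact Operand.represents_const a
  | input i => exact hargs i
  | reg r => exact hρ r

variable [Field K] {x : ι → K} {σ : MachineState K} {t t₁ t₂ : ℝ}

theorem Runs.mono {c : Fragment K ι κ α} {Q Q' : α → MachineState K → Prop}
    (h : Runs x c σ t₁ Q) (ht : t₁ ≤ t₂) (hQ : ∀ a σ', σ.Extends σ' → Q a σ' → Q' a σ') :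
    Runs x c σ t₂ Q' := by
  obtain ⟨a, σ', t', h1, h2, h3, h4⟩ := h
  exact ⟨a, σ', t', h1, h2.trans ht, hQ a σ' h1 h3, h4⟩

theorem runs_ret {a : α} {Q : α → MachineState K → Prop} (h : Q a σ) :
    Runs x (ret a : Fragment K ι κ α) σ 0 Q := by
  refine ⟨a, σ, 0, .refl σ, by simp, h, fun k => ?_⟩
  simp [ret]

theorem Runs.bind {c : Fragment K ι κ α} {f : α → Fragment K ι κ β}
    {Q : α → MachineState K → Prop} {Q' : β → MachineState K → Prop}
    (h : Runs x c σ t₁ Q)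
    (h' : ∀ a σ', σ.Extends σ' → Q a σ' → Runs x (f a) σ' t₂ Q') :
    Runs x (c.bind f) σ (t₁ + t₂) Q' := by
  obtain ⟨a, σ', t', h1, h2, h3, h4⟩ := h
  obtain ⟨b, σ'', t'', g1, g2, g3, g4⟩ := h' a σ' h1 h3
  refine ⟨b, σ'', t'' + t', h1.trans g1, ?_, g3, fun k => ?_⟩
  · push_cast; linarith
  · change (c σ.next _).execFrom x σ.mem = _
    rw [h4, g4, Option.map_map]
    congr 1
    funext r
    simp [add_assoc]

theorem runs_arith {o : ArithOp} {a b : Operand K ι} {va vb v : K}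
    (ha : a.Represents x σ va) (hb : b.Represents x σ vb) (hv : o.eval va vb = some v) :
    Runs x (arith o a b : Fragment K ι κ _) σ 1 fun r σ' => r.Represents x σ' v := by
  refine ⟨.reg σ.next, ⟨σ.next + 1, Function.update σ.mem σ.next v⟩, 1, ⟨Nat.le_succ _, ?_⟩,
    by simp, ⟨?_, ?_⟩, fun k => ?_⟩
  · intro r hr
    exact Function.update_of_ne hr.ne _ _
  · intro r hr
    cases hr
    exact Nat.lt_succ_self _
  · exact Function.update_self _ _ _
  · simp only [arith, ArithProgram.execFrom, ha.2, hb.2, hv, Option.bind_some]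

theorem runs_testZero {a : Operand K ι} {va : K} (ha : a.Represents x σ va) :
    Runs x (testZero a : Fragment K ι κ _) σ 1 fun z _ => (z = true ↔ va = 0) := by
  by_cases h : va = 0
  · refine ⟨true, σ, 1, .refl σ, by simp, by simp [h], fun k => ?_⟩
    simp only [testZero, ArithProgram.execFrom, ha.2, h, if_true]
  · refine ⟨false, σ, 1, .refl σ, by simp, by simp [h], fun k => ?_⟩
    simp only [testZero, ArithProgram.execFrom, ha.2, h, if_false]

theorem runs_traverseFin {n : ℕ} {f : Fin n → Fragment K ι κ α}
    {Q : Fin n → α → MachineState K → Prop}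
    (hQ : ∀ i a σ₁ σ₂, σ₁.Extends σ₂ → Q i a σ₁ → Q i a σ₂)
    (h : ∀ i σ', σ.Extends σ' → Runs x (f i) σ' t (Q i)) :
    Runs x (traverseFin f) σ (n * t) fun g σ' => ∀ i, Q i (g i) σ' := by
  induction n generalizing σ with
  | zero => exact (runs_ret fun i => i.elim0).mono (by simp) fun _ _ _ h => h
  | succ n ih =>
    have := (h 0 σ (.refl σ)).bind (t₂ := n * t + 0) (f := fun a =>
        (traverseFin fun i => f i.succ).bind fun g => ret (Fin.cons a g : Fin (n + 1) → α))
      (Q' := fun g σ' => ∀ i, Q i (g i) σ') fun a σ₁ h₁ ha =>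
        (ih (fun i => hQ i.succ) (fun i σ' hσ' => h i.succ σ' (h₁.trans hσ'))).bind
          fun g σ₂ h₂ hg => runs_ret <| by
            intro i
            refine Fin.cases ?_ (fun i => ?_) i
            · exact hQ _ _ _ _ h₂ ha
            · exact hg i
    refine this.mono ?_ fun _ _ _ h => h
    push_cast; linarith

theorem runs_traverse {I : Type*} [Fintype I] {f : I → Fragment K ι κ α}
    {Q : I → α → MachineState K → Prop}
    (hQ : ∀ i a σ₁ σ₂, σ₁.Extends σ₂ → Q i a σ₁ → Q i a σ₂)
    (h : ∀ i σ', σ.Extends σ' → Runs x (f i) σ' t (Q i)) :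
    Runs x (traverse f) σ (Fintype.card I * t) fun g σ' => ∀ i, Q i (g i) σ' := by
  have := (runs_traverseFin (f := fun i => f ((Fintype.equivFin I).symm i))
    (Q := fun i => Q ((Fintype.equivFin I).symm i)) (fun i => hQ _) (fun i => h _)).bind
    (f := fun g => ret fun i => g (Fintype.equivFin I i))
    (Q' := fun g σ' => ∀ i, Q i (g i) σ') fun g σ' _ hg => runs_ret fun i => by
      have := hg (Fintype.equivFin I i)
      simpa using this
  exact this.mono (by simp) fun _ _ _ h => h

theorem runs_nonzeroSet {I : Type*} [Fintype I] {a : I → Operand K ι} {v : I → K}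
    (ha : ∀ i, (a i).Represents x σ (v i)) :
    Runs x (nonzeroSet a : Fragment K ι κ _) σ (Fintype.card I) fun s _ =>
      ∀ i, i ∈ s ↔ v i ≠ 0 := by
  have := (runs_traverse (f := fun i => (testZero (a i) : Fragment K ι κ _))
    (Q := fun i z _ => z = true ↔ v i = 0) (fun _ _ _ _ _ h => h)
    (fun i σ' hσ' => runs_testZero ((ha i).mono hσ'))).bind
    (f := fun z => ret (Finset.univ.filter fun i => z i = false))
    (Q' := fun s _ => ∀ i, i ∈ s ↔ v i ≠ 0) fun z σ' _ hz => runs_ret fun i => by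
      simp [← hz]
  exact this.mono (by simp) fun _ _ _ h => h

theorem runs_innerProduct {n : ℕ} {a b : Fin n → Operand K ι} {va vb : Fin n → K}
    (ha : ∀ i, (a i).Represents x σ (va i)) (hb : ∀ i, (b i).Represents x σ (vb i)) :
    Runs x (innerProduct a b : Fragment K ι κ _) σ (2 * n) fun r σ' =>
      r.Represents x σ' (∑ i, va i * vb i) := by
  induction n generalizing σ with
  | zero =>
    refine Runs.mono (t₁ := 0) (Q := fun r σ' => Operand.Represents x σ' r (∑ i, va i * vb i))
      (runs_ret ?_) (by simp) fun _ _ _ h => h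
    rw [Fin.sum_univ_zero]
    exact Operand.represents_const 0
  | succ n ih =>
    have := (runs_arith (κ := κ) (ha 0) (hb 0) (o := .mul) rfl).bind (t₂ := 2 * n + 1)
      (f := fun p => (innerProduct (fun i => a i.succ) fun i => b i.succ).bind
        fun r => arith .add p r)
      (Q' := fun r σ' => r.Represents x σ' (∑ i, va i * vb i)) fun p σ₁ h₁ hp =>
        (ih (fun i => (ha i.succ).mono h₁) (fun i => (hb i.succ).mono h₁)).bind
          fun r σ₂ h₂ hr => runs_arith (hp.mono h₂) hr (by rw [Fin.sum_univ_succ]; rfl)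
    refine this.mono ?_ fun _ _ _ h => h
    push_cast; linarith

/-- An inlined program computes what the program computes, at the same cost, if
the operands `ρ` represent the contents `m` of its registers. -/
theorem runs_inline {ι' κ' : Type} {args : ι' → Operand K ι} {y : ι' → K}
    (p : ArithProgram K ι' κ') {ρ : ℕ → Operand K ι} {m : ℕ → K} {z : κ' → K} {t' : ℕ}
    (hargs : ∀ i, (args i).Represents x σ (y i)) (hρ : ∀ r, (ρ r).Represents x σ (m r))
    (hp : p.execFrom y m = some (z, t')) :
    Runs x (inline args p ρ : Fragment K ι κ _) σ t' fun out σ' =>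
      ∀ j, (out j).Represents x σ' (z j) := by
  induction p generalizing ρ m σ t' with
  | output out =>
    simp only [ArithProgram.execFrom, Option.some.injEq, Prod.mk.injEq] at hp
    obtain ⟨rfl, rfl⟩ := hp
    simpa [inline] using runs_ret fun j => substOperand_represents hargs hρ (out j)
  | compute op a b dst next ih =>
    simp only [ArithProgram.execFrom, Option.bind_eq_some_iff, Option.map_eq_some_iff,
      Prod.mk.injEq, Prod.exists] at hp
    obtain ⟨v, hv, z', t'', h1, rfl, rfl⟩ := hp
    refine ((runs_arith (substOperand_represents hargs hρ a) (substOperand_represents hargs hρ b)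
      hv).bind (t₂ := t'') fun r σ' hσ' hr => ih (fun i => (hargs i).mono hσ') (fun r' => ?_)
        h1).mono (by push_cast; linarith) fun _ _ _ h => h
    by_cases hr' : r' = dst
    · subst hr'; simpa using hr
    · simpa [hr'] using (hρ r').mono hσ'
  | ifZero a yes no ihy ihn =>
    simp only [ArithProgram.execFrom, Option.map_eq_some_iff, Prod.mk.injEq, Prod.exists] at hp
    obtain ⟨z', t'', h1, rfl, rfl⟩ := hp
    refine ((runs_testZero (substOperand_represents hargs hρ a)).bind (t₂ := t'')
      fun c σ' hσ' hc => ?_).mono (by push_cast; linarith) fun _ _ _ h => h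
    by_cases h0 : a.eval y m = 0
    · rw [if_pos h0] at h1
      rw [if_pos (hc.2 h0)]
      exact ihy (fun i => (hargs i).mono hσ') (fun r => (hρ r).mono hσ') h1
    · rw [if_neg h0] at h1
      rw [if_neg (fun h => h0 (hc.1 h))]
      exact ihn (fun i => (hargs i).mono hσ') (fun r => (hρ r).mono hσ') h1

/-- The program that executes a fragment and returns its result. -/
def toProgram (c : Fragment K ι κ (κ → Operand K ι)) : ArithProgram K ι κ :=
  c 0 fun out _ => .output out

theorem Runs.exec_toProgram {c : Fragment K ι κ (κ → Operand K ι)} {Q : (κ → K) → Prop}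
    (h : Runs x c ⟨0, fun _ => 0⟩ t fun out σ' =>
      ∃ y, Q y ∧ ∀ j, (out j).Represents x σ' (y j)) :
    ∃ (y : κ → K) (t' : ℕ), c.toProgram.exec x = some (y, t') ∧ (t' : ℝ) ≤ t ∧ Q y := by
  obtain ⟨out, σ', t', -, h2, ⟨y, hy, hout⟩, h4⟩ := h
  refine ⟨y, t', ?_, h2, hy⟩
  have := h4 fun out _ => .output out
  rw [toProgram, ArithProgram.exec, this]
  simp only [ArithProgram.execFrom, Option.map_some, Option.some.injEq, Prod.mk.injEq,
    zero_add, and_true]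
  exact funext fun j => (hout j).2

end Fragment

/-! ### Reduced row echelon forms and bases of kernels -/

section ReducedForm

open Matrix

variable {K : Type*} [Field K] {I I' P : Type*} [Fintype P]

/-- `r` has the same kernel as `a`, and it is in reduced form: for each row `i` either `J i = none`
and the row vanishes, or `J i = some p` and the column `p` of `r` is the `i`-th unit vector. -/
structure IsReducedForm (a : Matrix I P K) (r : Matrix I' P K) (J : I' → Option P) : Prop where
  ker : ∀ x : P → K, a *ᵥ x = 0 ↔ r *ᵥ x = 0
  row_eq_zero : ∀ i, J i = none → r i = 0
  pivot_self : ∀ i p, J i = some p → r i p = 1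
  pivot_ne : ∀ i p, J i = some p → ∀ i', i' ≠ i → r i' p = 0

/-- The columns of `A` with the indices `J`; the entries of missing columns are `z`. -/
def selectColumns {β : Type*} (z : β) (A : I → P → β) (J : I' → Option P) : Matrix I I' β :=
  fun i i' => (J i').elim z (A i)

/-- A block row reduction. The pivots of the upper half are used to clear their columns in the
lower half before that half is reduced; then the pivots of the lower half are used to clear their
columns in the upper half. -/
theorem IsReducedForm.fromRows {I₁ I₂ : Type*} [Fintype I₁] [Fintype I₂]
    {a₁ r₁ : Matrix I₁ P K} {a₂ r₂ : Matrix I₂ P K} {J₁ : I₁ → Option P} {J₂ : I₂ → Option P}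
    (h₁ : IsReducedForm a₁ r₁ J₁)
    (h₂ : IsReducedForm (a₂ - selectColumns 0 a₂ J₁ * r₁) r₂ J₂) :
    IsReducedForm (Matrix.fromRows a₁ a₂)
      (Matrix.fromRows (r₁ - selectColumns 0 r₁ J₂ * r₂) r₂)
      (Sum.elim J₁ J₂) := by
  classical
  -- the pivot columns of the upper half vanish in `r₂`
  have hz : ∀ i p, J₁ i = some p → ∀ i', r₂ i' p = 0 := by
    intro i p hp i'
    have h0 : (a₂ - selectColumns 0 a₂ J₁ * r₁) *ᵥ Pi.single p 1 = 0 := by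
      ext i₂
      rw [mulVec_single_one, col_apply, Matrix.sub_apply, mul_apply, Finset.sum_eq_single i]
      · simp [selectColumns, hp, h₁.pivot_self i p hp]
      · intro b _ hb
        rw [h₁.pivot_ne i p hp b hb, mul_zero]
      · simp
    have := congrFun ((h₂.ker _).1 h0) i'
    rwa [mulVec_single_one] at this
  have hsplit : ∀ {b₁ : Matrix I₁ P K} {b₂ : Matrix I₂ P K} {x : P → K},
      Matrix.fromRows b₁ b₂ *ᵥ x = 0 ↔ b₁ *ᵥ x = 0 ∧ b₂ *ᵥ x = 0 := by
    intro b₁ b₂ x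
    rw [fromRows_mulVec]
    constructor
    · exact fun h => ⟨funext fun i => congrFun h (.inl i), funext fun i => congrFun h (.inr i)⟩
    · rintro ⟨h1, h2⟩
      rw [h1, h2]
      ext i
      cases i <;> rfl
  refine ⟨fun x => ?_, ?_, ?_, ?_⟩
  · rw [hsplit, hsplit, h₁.ker]
    have e1 : r₁ *ᵥ x = 0 → (a₂ *ᵥ x = 0 ↔ r₂ *ᵥ x = 0) := fun h => by
      rw [← h₂.ker, sub_mulVec, ← mulVec_mulVec, h, mulVec_zero, sub_zero]
    have e2 : r₂ *ᵥ x = 0 → ((r₁ - selectColumns 0 r₁ J₂ * r₂) *ᵥ x = 0 ↔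
        r₁ *ᵥ x = 0) := fun h => by
      rw [sub_mulVec, ← mulVec_mulVec, h, mulVec_zero, sub_zero]
    constructor
    · rintro ⟨h1, h2⟩
      have h3 := (e1 h1).1 h2
      exact ⟨(e2 h3).2 h1, h3⟩
    · rintro ⟨h1, h3⟩
      have h1 := (e2 h3).1 h1
      exact ⟨h1, (e1 h1).2 h3⟩
  · rintro (i | i) hi
    · have h0 := h₁.row_eq_zero i hi
      ext p
      rw [fromRows_apply_inl, Matrix.sub_apply, h0, mul_apply, Finset.sum_eq_zero]
      · simp
      · intro i₂ _
        have : selectColumns 0 r₁ J₂ i i₂ = 0 := by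
          unfold selectColumns
          cases J₂ i₂ <;> simp [h0]
        rw [this, zero_mul]
    · ext p
      rw [fromRows_apply_inr, h₂.row_eq_zero i hi]
  · rintro (i | i) p hp
    · rw [fromRows_apply_inl, Matrix.sub_apply, mul_apply, h₁.pivot_self i p hp]
      simp [hz i p hp]
    · exact h₂.pivot_self i p hp
  · rintro (i | i) p hp (i' | i') hi
    · rw [fromRows_apply_inl, Matrix.sub_apply, mul_apply,
        h₁.pivot_ne i p hp i' fun h => hi (congrArg _ h)]
      simp [hz i p hp]
    · exact hz i p hp i'
    · rw [fromRows_apply_inl, Matrix.sub_apply, mul_apply, Finset.sum_eq_single i]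
      · have hp' : J₂ i = some p := hp
        simp [selectColumns, hp', h₂.pivot_self i p hp']
      · intro b _ hb
        rw [h₂.pivot_ne i p hp b hb, mul_zero]
      · simp
    · exact h₂.pivot_ne i p hp i' fun h => hi (congrArg _ h)

/-- The vectors `N p`, for `p` in `s`, are the basis of the kernel of `a` which is dual to the
coordinates in `s`. -/
structure IsKernelBasis (a : Matrix I P K) (s : Finset P) (N : P → P → K) : Prop where
  mulVec_eq_zero : ∀ p ∈ s, a *ᵥ N p = 0
  apply_self : ∀ p, N p p = 1
  apply_ne : ∀ p, ∀ q ∈ s, q ≠ p → N p q = 0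
  eq_sum : ∀ x, a *ᵥ x = 0 → x = ∑ p ∈ s, x p • N p

/-- The restriction to the coordinates in `s` is an isomorphism from the kernel to `K ^ s`. -/
theorem IsKernelBasis.card_add_rank [Fintype I] {a : Matrix I P K} {s : Finset P} {N : P → P → K}
    (h : IsKernelBasis a s N) : s.card + a.rank = Fintype.card P := by
  classical
  let φ : LinearMap.ker a.mulVecLin →ₗ[K] (s → K) :=
    (LinearMap.funLeft K K ((↑) : s → P)).comp (LinearMap.ker a.mulVecLin).subtype
  have hinj : Function.Injective φ := by
    rw [injective_iff_map_eq_zero]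
    rintro ⟨x, hx⟩ h0
    ext1
    change x = 0
    rw [h.eq_sum x (by simpa using hx)]
    refine Finset.sum_eq_zero fun p hp => ?_
    have : x p = 0 := congrFun h0 ⟨p, hp⟩
    rw [this, zero_smul]
  have hsurj : Function.Surjective φ := by
    intro y
    refine ⟨⟨∑ p : s, y p • N p, ?_⟩, ?_⟩
    · rw [LinearMap.mem_ker, map_sum]
      refine Finset.sum_eq_zero fun p _ => ?_
      rw [map_smul, mulVecLin_apply, h.mulVec_eq_zero _ p.2, smul_zero]
    · ext q
      change (∑ p : s, y p • N p) q = y q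
      rw [Finset.sum_apply, Finset.sum_eq_single q]
      · simp [h.apply_self]
      · intro p _ hpq
        rw [Pi.smul_apply, h.apply_ne _ _ q.2 fun e => hpq (Subtype.ext e.symm), smul_zero]
      · simp
  have h1 := (LinearEquiv.ofBijective φ ⟨hinj, hsurj⟩).finrank_eq
  have h2 := a.mulVecLin.finrank_range_add_finrank_ker
  rw [h1, Module.finrank_fintype_fun_eq_card, Module.finrank_fintype_fun_eq_card,
    Fintype.card_coe] at h2
  rw [Matrix.rank]
  omega

/-- The basis of the kernel can be read off from a reduced form. -/
theorem IsReducedForm.isKernelBasis {a : Matrix I P K} {r : Matrix I' P K}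
    {J : I' → Option P} (h : IsReducedForm a r J) {s : Finset P}
    (hs : ∀ p, p ∈ s ↔ ∀ i, J i ≠ some p) {N : P → P → K} (hself : ∀ p, N p p = 1)
    (hpivot : ∀ p q i, q ≠ p → J i = some q → N p q = - r i p)
    (hne : ∀ p q, q ≠ p → (∀ i, J i ≠ some q) → N p q = 0) :
    IsKernelBasis a s N := by
  classical
  have hmem : ∀ p ∈ s, a *ᵥ N p = 0 := by
    intro p hp
    rw [h.ker]
    ext i
    change ∑ q, r i q * N p q = 0
    rcases hJ : J i with _ | q
    · simp [h.row_eq_zero i hJ]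
    · have hqp : q ≠ p := by rintro rfl; exact (hs _).1 hp i hJ
      rw [← Finset.add_sum_erase _ _ (Finset.mem_univ p),
        ← Finset.add_sum_erase _ _ (Finset.mem_erase.2 ⟨hqp, Finset.mem_univ q⟩),
        Finset.sum_eq_zero]
      · rw [hself, hpivot p q i hqp hJ, h.pivot_self i q hJ]; ring
      · intro q' hq'
        obtain ⟨h1, h2⟩ := Finset.mem_erase.1 hq'
        obtain ⟨h3, -⟩ := Finset.mem_erase.1 h2
        by_cases hq : ∃ i', J i' = some q'
        · obtain ⟨i', hi'⟩ := hq
          rw [h.pivot_ne i' q' hi' i, zero_mul]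
          rintro rfl
          rw [hJ] at hi'
          exact h1 (Option.some.inj hi').symm
        · push Not at hq
          rw [hne p q' h3 hq, mul_zero]
  refine ⟨hmem, hself, fun p q hq hqp => hne p q hqp ((hs q).1 hq), fun x hx => ?_⟩
  rw [← sub_eq_zero]
  set y := x - ∑ p ∈ s, x p • N p with hy
  have hys : ∀ q ∈ s, y q = 0 := by
    intro q hq
    rw [hy, Pi.sub_apply, Finset.sum_apply, Finset.sum_eq_single q]
    · simp [hself]
    · intro p _ hpq
      rw [Pi.smul_apply, hne p q hpq.symm ((hs q).1 hq), smul_zero]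
    · exact fun h => absurd hq h
  have hry : r *ᵥ y = 0 := by
    rw [← h.ker, hy, mulVec_sub, hx, zero_sub, neg_eq_zero, ← mulVecLin_apply, map_sum]
    refine Finset.sum_eq_zero fun p hp => ?_
    rw [map_smul, mulVecLin_apply, hmem p hp, smul_zero]
  ext q
  by_cases hq : q ∈ s
  · exact hys q hq
  · have : ∃ i, J i = some q := by
      by_contra hcon
      push Not at hcon
      exact hq ((hs q).2 hcon)
    obtain ⟨i, hi⟩ := this
    have h1 : ∑ q', r i q' * y q' = 0 := congrFun hry i
    rw [Finset.sum_eq_single q, h.pivot_self i q hi, one_mul] at h1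
    · exact h1
    · intro q' _ hq'
      by_cases hq's : q' ∈ s
      · rw [hys q' hq's, mul_zero]
      · have : ∃ i, J i = some q' := by
          by_contra hcon
          push Not at hcon
          exact hq's ((hs q').2 hcon)
        obtain ⟨i', hi'⟩ := this
        rw [h.pivot_ne i' q' hi' i, zero_mul]
        rintro rfl
        rw [hi] at hi'
        exact hq' (Option.some.inj hi').symm
    · simp

end ReducedForm

/-! ### Row reduction by fast matrix multiplication -/

/-- An index set with `2 ^ t` elements, which is split into two halves by definition. -/
def BlockIndex : ℕ → Type
  | 0 => Unit
  | t + 1 => BlockIndex t ⊕ BlockIndex t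

instance BlockIndex.instFintype : ∀ t, Fintype (BlockIndex t)
  | 0 => inferInstanceAs (Fintype Unit)
  | t + 1 =>
    let _ := BlockIndex.instFintype t
    inferInstanceAs (Fintype (BlockIndex t ⊕ BlockIndex t))

theorem BlockIndex.card (t : ℕ) : Fintype.card (BlockIndex t) = 2 ^ t := by
  induction t with
  | zero => rfl
  | succ t ih =>
    have : Fintype.card (BlockIndex (t + 1)) = Fintype.card (BlockIndex t ⊕ BlockIndex t) := rfl
    rw [this, Fintype.card_sum, ih, pow_succ]; ring

/-- A numbering of the elements of `BlockIndex t`. -/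
noncomputable def BlockIndex.equivFin (t : ℕ) : BlockIndex t ≃ Fin (2 ^ t) :=
  Fintype.equivFinOfCardEq (BlockIndex.card t)

namespace Fragment

section Programs

variable {K : Type u} [Field K] {ι κ : Type} {I J P : Type}

/-- The product of two matrices. The indices of the rows and of the columns of the first factor are
embedded into `Fin s` by `eI` and `eJ`, and the columns of the second factor are arranged by `eP`
in `q` blocks of width `s`. Every block is multiplied by the program `p` for `s × s` matrices, where
missing entries are replaced by zeros. -/
noncomputable def mulBlocks {s q : ℕ}
    (p : ArithProgram K ((Fin s × Fin s) ⊕ (Fin s × Fin s)) (Fin s × Fin s))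
    (eI : I → Fin s) (eJ : J → Fin s) (eP : P → Fin q × Fin s)
    (A : I → J → Operand K ι) (B : J → P → Operand K ι) :
    Fragment K ι κ (I → P → Operand K ι) :=
  (traverse fun b : Fin q => inline
    (Sum.elim
      (fun ij => Function.extend (Prod.map eI eJ) (Function.uncurry A) (fun _ => .const 0) ij)
      (fun ij => Function.extend (Prod.map eJ eP) (Function.uncurry B) (fun _ => .const 0)
        (ij.1, (b, ij.2))))
    p fun _ => .const 0).bind fun C => ret fun i j => C (eP j).1 (eI i, (eP j).2)

/-- The matrix `C - A * B`, where the product is computed by `mulBlocks`. -/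
noncomputable def subMul [Fintype I] [Fintype P] {s q : ℕ}
    (p : ArithProgram K ((Fin s × Fin s) ⊕ (Fin s × Fin s)) (Fin s × Fin s))
    (eI : I → Fin s) (eJ : J → Fin s) (eP : P → Fin q × Fin s)
    (C : I → P → Operand K ι) (A : I → J → Operand K ι) (B : J → P → Operand K ι) :
    Fragment K ι κ (I → P → Operand K ι) :=
  (mulBlocks p eI eJ eP A B).bind fun D =>
    (traverse fun ij : I × P => arith .sub (C ij.1 ij.2) (D ij.1 ij.2)).bind fun E =>
      ret fun i j => E (i, j)

/-- Row reduction of a matrix with `2 ^ t` rows, by recursion on `t`. The result consists of the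
entries of the reduced matrix and of the column of the pivot of each row. -/
noncomputable def rowReduce [Fintype P]
    (p : ∀ s, ArithProgram K ((Fin s × Fin s) ⊕ (Fin s × Fin s)) (Fin s × Fin s))
    {q : ℕ → ℕ} (eP : ∀ t, P → Fin (q t) × Fin (2 ^ t)) : ∀ t : ℕ,
      (BlockIndex t → P → Operand K ι) →
        Fragment K ι κ ((BlockIndex t → P → Operand K ι) × (BlockIndex t → Option P))
  | 0, A => (nonzeroSet (A ())).bind fun s =>
      open Classical in
      if h : s.Nonempty then
        (traverse fun j => arith .div (A () j) (A () h.choose)).bind fun R =>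
          ret (fun _ => R, fun _ => some h.choose)
      else ret (A, fun _ => none)
  | t + 1, A =>
      (rowReduce p eP t fun i => A (.inl i)).bind fun R₁ =>
        (subMul (p (2 ^ t)) (BlockIndex.equivFin t) (BlockIndex.equivFin t) (eP t)
          (fun i => A (.inr i)) (selectColumns (.const 0) (fun i => A (.inr i)) R₁.2) R₁.1).bind
        fun A₂ => (rowReduce p eP t A₂).bind fun R₂ =>
          (subMul (p (2 ^ t)) (BlockIndex.equivFin t) (BlockIndex.equivFin t) (eP t)
            R₁.1 (selectColumns (.const 0) R₁.1 R₂.2) R₂.1).bind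
          fun A₁ => ret (Sum.elim A₁ R₂.1, Sum.elim R₁.2 R₂.2)

/-- The number of operations of `rowReduce` for a matrix with `2 ^ t` rows and `N` columns, if
`s × s` matrices are multiplied within `τ s` operations. -/
def rowReduceCost (τ : ℕ → ℝ) (q : ℕ → ℕ) (N : ℝ) : ℕ → ℝ
  | 0 => 2 * N
  | t + 1 => 2 * rowReduceCost τ q N t + 2 * (q t * τ (2 ^ t) + 2 ^ t * N)

variable {x : ι → K} {σ : MachineState K}

theorem extend_represents {A B : Type*} {e : A → B} (he : Function.Injective e)
    {f : A → Operand K ι} {v : A → K} (hf : ∀ a, (f a).Represents x σ (v a)) (b : B) :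
    (Function.extend e f (fun _ => .const 0) b).Represents x σ
      (Function.extend e v (fun _ => 0) b) := by
  by_cases hb : ∃ a, e a = b
  · obtain ⟨a, rfl⟩ := hb
    rw [he.extend_apply, he.extend_apply]
    exact hf a
  · rw [Function.extend_apply' _ _ _ hb, Function.extend_apply' _ _ _ hb]
    exact Operand.represents_const 0

theorem runs_mulBlocks [Fintype J] {s q : ℕ} {τ : ℝ}
    {p : ArithProgram K ((Fin s × Fin s) ⊕ (Fin s × Fin s)) (Fin s × Fin s)}
    (hp : ∀ A B : Matrix (Fin s) (Fin s) K, ∃ t : ℕ,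
      p.exec (Sum.elim (fun ij => A ij.1 ij.2) (fun ij => B ij.1 ij.2)) =
          some (fun ij => (A * B) ij.1 ij.2, t) ∧ (t : ℝ) ≤ τ)
    {eI : I → Fin s} {eJ : J → Fin s} {eP : P → Fin q × Fin s} (hI : Function.Injective eI)
    (hJ : Function.Injective eJ) (hP : Function.Injective eP)
    {A : I → J → Operand K ι} {B : J → P → Operand K ι} {a : Matrix I J K} {b : Matrix J P K}
    (hA : ∀ i j, (A i j).Represents x σ (a i j)) (hB : ∀ i j, (B i j).Represents x σ (b i j)) :
    Runs x (mulBlocks p eI eJ eP A B : Fragment K ι κ _) σ (q * τ) fun D σ' =>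
      ∀ i j, (D i j).Represents x σ' ((a * b) i j) := by
  let a' : Matrix (Fin s) (Fin s) K := fun i j =>
    Function.extend (Prod.map eI eJ) (Function.uncurry a) (fun _ => 0) (i, j)
  let b' : Fin q → Matrix (Fin s) (Fin s) K := fun c i j =>
    Function.extend (Prod.map eJ eP) (Function.uncurry b) (fun _ => 0) (i, (c, j))
  have hmul : ∀ i j, (a' * b' (eP j).1) (eI i) (eP j).2 = (a * b) i j := by
    intro i j
    rw [Matrix.mul_apply, Matrix.mul_apply]
    symm
    refine Finset.sum_of_injOn eJ hJ.injOn (fun _ _ => Finset.mem_coe.2 (Finset.mem_univ _))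
      ?_ ?_
    · intro k _ hk
      have : ¬ ∃ ij : I × J, Prod.map eI eJ ij = (eI i, k) := by
        rintro ⟨⟨i', j'⟩, h⟩
        exact hk ⟨j', by simp, (Prod.ext_iff.1 h).2⟩
      simp only [a', Function.extend_apply' _ _ _ this, zero_mul]
    · intro k _
      have h1 : a' (eI i) (eJ k) = a i k :=
        (hI.prodMap hJ).extend_apply (Function.uncurry a) _ (i, k)
      have h2 : b' (eP j).1 (eJ k) (eP j).2 = b k j :=
        (hJ.prodMap hP).extend_apply (Function.uncurry b) _ (k, j)
      rw [h1, h2]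
  have := (runs_traverse (t := τ) (x := x) (σ := σ) (κ := κ)
    (f := fun c : Fin q => inline
      (Sum.elim
        (fun ij => Function.extend (Prod.map eI eJ) (Function.uncurry A) (fun _ => .const 0) ij)
        (fun ij => Function.extend (Prod.map eJ eP) (Function.uncurry B) (fun _ => .const 0)
          (ij.1, (c, ij.2)))) p fun _ => .const 0)
    (Q := fun c D σ' => ∀ ij : Fin s × Fin s, (D ij).Represents x σ' ((a' * b' c) ij.1 ij.2))
    (fun c D σ₁ σ₂ h hD ij => (hD ij).mono h)
    (fun c σ' hσ' => by
      obtain ⟨t, ht, htτ⟩ := hp a' (b' c)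
      refine (runs_inline p ?_ (fun r => Operand.represents_const 0) ht).mono htτ
        fun _ _ _ h => h
      rintro (ij | ij)
      · exact extend_represents (hI.prodMap hJ) (fun ij => (hA ij.1 ij.2).mono hσ') ij
      · exact extend_represents (hJ.prodMap hP) (fun ij => (hB ij.1 ij.2).mono hσ') _)).bind
    (f := fun C => ret fun i j => C (eP j).1 (eI i, (eP j).2))
    (Q' := fun D σ' => ∀ i j, (D i j).Represents x σ' ((a * b) i j))
    fun D σ' _ hD => runs_ret fun i j => by
      have := hD (eP j).1 (eI i, (eP j).2)
      rwa [hmul] at this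
  exact this.mono (by simp) fun _ _ _ h => h

theorem runs_subMul [Fintype I] [Fintype J] [Fintype P] {s q : ℕ} {τ : ℝ}
    {p : ArithProgram K ((Fin s × Fin s) ⊕ (Fin s × Fin s)) (Fin s × Fin s)}
    (hp : ∀ A B : Matrix (Fin s) (Fin s) K, ∃ t : ℕ,
      p.exec (Sum.elim (fun ij => A ij.1 ij.2) (fun ij => B ij.1 ij.2)) =
          some (fun ij => (A * B) ij.1 ij.2, t) ∧ (t : ℝ) ≤ τ)
    {eI : I → Fin s} {eJ : J → Fin s} {eP : P → Fin q × Fin s} (hI : Function.Injective eI)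
    (hJ : Function.Injective eJ) (hP : Function.Injective eP)
    {C : I → P → Operand K ι} {A : I → J → Operand K ι} {B : J → P → Operand K ι}
    {c : Matrix I P K} {a : Matrix I J K} {b : Matrix J P K}
    (hC : ∀ i j, (C i j).Represents x σ (c i j))
    (hA : ∀ i j, (A i j).Represents x σ (a i j)) (hB : ∀ i j, (B i j).Represents x σ (b i j)) :
    Runs x (subMul p eI eJ eP C A B : Fragment K ι κ _) σ
      (q * τ + Fintype.card I * Fintype.card P) fun D σ' =>
      ∀ i j, (D i j).Represents x σ' ((c - a * b) i j) := by
  refine Runs.bind (runs_mulBlocks hp hI hJ hP hA hB) fun D σ₁ h₁ hD => ?_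
  refine Runs.mono (Runs.bind (runs_traverse (t := 1)
    (Q := fun ij r σ' => Operand.Represents x σ' r ((c - a * b) ij.1 ij.2))
    (fun ij r σ₁ σ₂ h (hr : Operand.Represents x σ₁ r ((c - a * b) ij.1 ij.2)) => hr.mono h)
    (fun ij σ' h => runs_arith ((hC _ _).mono (h₁.trans h)) ((hD _ _).mono h) rfl))
    (fun E σ₂ h₂ hE => runs_ret fun i j => hE (i, j))) ?_ fun _ _ _ h => h
  rw [Fintype.card_prod]; push_cast; linarith

theorem selectColumns_represents {I' : Type} {A : I → P → Operand K ι} {a : I → P → K}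
    (hA : ∀ i j, (A i j).Represents x σ (a i j)) (J : I' → Option P) (i : I) (i' : I') :
    (selectColumns (.const 0) A J i i').Represents x σ (selectColumns 0 a J i i') := by
  unfold selectColumns
  cases J i' with
  | none => exact Operand.represents_const 0
  | some j => exact hA i j

theorem runs_rowReduce [Fintype P] {τ : ℕ → ℝ}
    {p : ∀ s, ArithProgram K ((Fin s × Fin s) ⊕ (Fin s × Fin s)) (Fin s × Fin s)}
    (hp : ∀ s, ∀ A B : Matrix (Fin s) (Fin s) K, ∃ t : ℕ,
      (p s).exec (Sum.elim (fun ij => A ij.1 ij.2) (fun ij => B ij.1 ij.2)) =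
          some (fun ij => (A * B) ij.1 ij.2, t) ∧ (t : ℝ) ≤ τ s)
    {q : ℕ → ℕ} {eP : ∀ t, P → Fin (q t) × Fin (2 ^ t)} (t : ℕ)
    (hP : ∀ i < t, Function.Injective (eP i))
    {A : BlockIndex t → P → Operand K ι} {a : Matrix (BlockIndex t) P K}
    (hA : ∀ i j, (A i j).Represents x σ (a i j)) :
    Runs x (rowReduce p eP t A : Fragment K ι κ _) σ (rowReduceCost τ q (Fintype.card P) t)
      fun R σ' => ∃ r : Matrix (BlockIndex t) P K, (∀ i j, (R.1 i j).Represents x σ' (r i j)) ∧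
        IsReducedForm a r R.2 := by
  induction t generalizing σ with
  | zero =>
    refine ((runs_nonzeroSet (hA ())).bind (t₂ := Fintype.card P) fun s σ₁ h₁ hs => ?_).mono
      (by simp only [rowReduceCost]; linarith) fun _ _ _ h => h
    by_cases h : s.Nonempty
    · -- dividing the row by one of its nonzero entries makes that entry a pivot
      rw [dif_pos h]
      have hne := (hs _).1 h.choose_spec
      refine ((runs_traverse (t := 1)
        (Q := fun j r σ' => Operand.Represents x σ' r (a () j / a () h.choose))
        (fun j r σ₁ σ₂ h hr => hr.mono h)
        (fun j σ' h' => runs_arith ((hA () _).mono (h₁.trans h')) ((hA () _).mono (h₁.trans h'))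
          (by simp only [ArithOp.eval]; rw [if_neg hne]))).bind
        fun E σ₂ h₂ hE => runs_ret
          ⟨fun _ j => a () j / a () h.choose, fun _ j => hE j, ⟨fun y => ?_, ?_, ?_, ?_⟩⟩).mono
        (by simp) fun _ _ _ h => h
      · have : (fun _ j => a () j / a () h.choose : Matrix (BlockIndex 0) P K)
            = (a () h.choose)⁻¹ • a := by
          ext i j
          rw [Matrix.smul_apply, smul_eq_mul, div_eq_inv_mul]
          rfl
        rw [this, Matrix.smul_mulVec, smul_eq_zero_iff_right (inv_ne_zero hne)]
      · intro i hi; simp at hi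
      · rintro i j hj
        obtain rfl := Option.some.inj hj
        exact div_self hne
      · intro i j _ i' hi'
        exact absurd (show (i' : Unit) = i from rfl) hi'
    · rw [dif_neg h]
      refine (runs_ret ⟨a, fun i j => (hA i j).mono h₁, ⟨fun y => Iff.rfl, ?_, ?_, ?_⟩⟩).mono
        (by simp) fun _ _ _ h => h
      · intro i _
        ext j
        by_contra h0
        exact h ⟨j, (hs j).2 h0⟩
      · intro i j hj; simp at hj
      · intro i j hj; simp at hj
  | succ t ih =>
    have hP' : ∀ i < t, Function.Injective (eP i) := fun i hi => hP i (hi.trans (Nat.lt_succ_self t))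
    refine Runs.mono (Runs.bind (ih hP' (a := fun i => a (.inl i)) fun i j => hA (.inl i) j)
      fun R₁ σ₁ h₁ hR₁ => ?_) (t₁ := rowReduceCost τ q (Fintype.card P) t +
        ((q t * τ (2 ^ t) + 2 ^ t * Fintype.card P) + (rowReduceCost τ q (Fintype.card P) t +
          ((q t * τ (2 ^ t) + 2 ^ t * Fintype.card P) + 0))))
      (by simp only [rowReduceCost]; linarith) fun _ _ _ h => h
    obtain ⟨r₁, hr₁, hred₁⟩ := hR₁
    have hA₂ : ∀ i j, (A (.inr i) j).Represents x σ₁ (a (.inr i) j) := fun i j =>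
      (hA (.inr i) j).mono h₁
    have hcard : (Fintype.card (BlockIndex t) : ℝ) = 2 ^ t := by
      rw [BlockIndex.card]; push_cast; rfl
    have hsub : ∀ {σ : MachineState K} {C : BlockIndex t → P → Operand K ι}
        {A : BlockIndex t → BlockIndex t → Operand K ι} {B : BlockIndex t → P → Operand K ι}
        {c : Matrix (BlockIndex t) P K} {a : Matrix (BlockIndex t) (BlockIndex t) K}
        {b : Matrix (BlockIndex t) P K},
        (∀ i j, (C i j).Represents x σ (c i j)) → (∀ i j, (A i j).Represents x σ (a i j)) →
        (∀ i j, (B i j).Represents x σ (b i j)) →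
        Runs x (subMul (p (2 ^ t)) (BlockIndex.equivFin t) (BlockIndex.equivFin t) (eP t) C A B :
          Fragment K ι κ _) σ (q t * τ (2 ^ t) + 2 ^ t * Fintype.card P) fun D σ' =>
          ∀ i j, (D i j).Represents x σ' ((c - a * b) i j) := fun hC hA hB =>
      (runs_subMul (hp _) (BlockIndex.equivFin t).injective (BlockIndex.equivFin t).injective
        (hP t (Nat.lt_succ_self t)) hC hA hB).mono (by rw [hcard]) fun _ _ _ h => h
    -- the pivot columns of the upper half are cleared in the lower half
    refine Runs.bind (hsub hA₂ (selectColumns_represents hA₂ R₁.2) hr₁) fun A₂ σ₂ h₂ hA₂' => ?_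
    refine Runs.bind (ih hP' hA₂') fun R₂ σ₃ h₃ hR₂ => ?_
    obtain ⟨r₂, hr₂, hred₂⟩ := hR₂
    have hr₁' : ∀ i j, (R₁.1 i j).Represents x σ₃ (r₁ i j) := fun i j =>
      (hr₁ i j).mono (h₂.trans h₃)
    -- the pivot columns of the lower half are cleared in the upper half
    refine Runs.bind (hsub hr₁' (selectColumns_represents hr₁' R₂.2) hr₂) fun A₁ σ₄ h₄ hA₁ => ?_
    refine runs_ret ⟨Matrix.fromRows (r₁ - selectColumns 0 r₁ R₂.2 * r₂) r₂, ?_, ?_⟩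
    · rintro (i | i) j
      · exact hA₁ i j
      · exact (hr₂ i j).mono h₄
    · have h := hred₁.fromRows hred₂
      have e : Matrix.fromRows (fun i => a (.inl i)) (fun i => a (.inr i)) = a := by
        ext (i | i) j <;> rfl
      rw [e] at h
      exact h

end Programs

end Fragment

namespace Fragment

/-- If `s × s` matrices are multiplied within `c * s ^ ω` operations, the cost at depth `i` of the
recursion is proportional to `(2 ^ (ω - 2)) ^ i`, so that the total cost is a geometric sum. -/
theorem rowReduceCost_le {ω c N : ℝ} (hω : 2 < ω) {T : ℕ} (hN : N ≤ 2 ^ T) {t : ℕ}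
    (ht : t ≤ T) :
    rowReduceCost (fun s => c * (s : ℝ) ^ ω) (fun t => 2 ^ (T - t)) N t ≤
      2 ^ t * 2 ^ T * (2 + (1 + c) * ∑ i ∈ Finset.range t, ((2 : ℝ) ^ (ω - 2)) ^ i) := by
  induction t with
  | zero => simp only [rowReduceCost, Finset.range_zero, Finset.sum_empty]; linarith
  | succ t ih =>
    have h1 := ih (by omega)
    set r : ℝ := (2 : ℝ) ^ (ω - 2) with hr
    have hr1 : 1 ≤ r ^ t := one_le_pow₀ (Real.one_le_rpow (by norm_num) (by linarith))
    have h2 : (((2 ^ t : ℕ) : ℝ)) ^ ω = (2 : ℝ) ^ t * 2 ^ t * r ^ t := by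
      have : (2 : ℝ) ^ ω = 2 * 2 * r := by
        rw [hr, Real.rpow_sub (by norm_num)]; norm_num; ring
      push_cast
      rw [← Real.rpow_natCast, ← Real.rpow_mul (by norm_num), mul_comm, Real.rpow_mul (by norm_num),
        Real.rpow_natCast, this, mul_pow, mul_pow, Real.rpow_natCast]
    have h3 : ((2 ^ (T - t) : ℕ) : ℝ) * 2 ^ t = 2 ^ T := by
      push_cast
      rw [← pow_add, Nat.sub_add_cancel (by omega)]
    simp only [rowReduceCost]
    rw [h2, Finset.sum_range_succ, pow_succ]
    have h4 : ((2 ^ (T - t) : ℕ) : ℝ) * (c * ((2 : ℝ) ^ t * 2 ^ t * r ^ t))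
        = 2 ^ t * 2 ^ T * (c * r ^ t) := by
      rw [← h3]; ring
    have h5 : (2 : ℝ) ^ t * N ≤ 2 ^ t * 2 ^ T * r ^ t := by
      rw [mul_assoc]
      refine mul_le_mul_of_nonneg_left (hN.trans ?_) (by positivity)
      exact le_mul_of_one_le_right (by positivity) hr1
    rw [h4]
    nlinarith [h1, h5]

variable {K : Type u} [Field K] {ι κ : Type} {I I' P : Type} [Fintype P]

open Classical in
/-- The columns without a pivot in a reduced form with pivots `J`. -/
noncomputable def freeColumns (J : I' → Option P) : Finset P :=
  Finset.univ.filter fun p => ∀ i, J i ≠ some p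

open Classical in
/-- The basis of the kernel of a matrix with reduced form `R` and pivots `J`. -/
noncomputable def kernelVectors (R : I' → P → Operand K ι) (J : I' → Option P) :
    Fragment K ι κ (P → P → Operand K ι) :=
  (traverse fun pq : P × P =>
    if pq.2 = pq.1 then ret (.const 1)
    else if h : ∃ i, J i = some pq.2 then arith .sub (.const 0) (R h.choose pq.1)
    else ret (.const 0)).bind fun E => ret fun p q => E (p, q)

theorem runs_kernelVectors {x : ι → K} {σ : MachineState K} {R : I' → P → Operand K ι}
    {a : Matrix I P K} {r : Matrix I' P K} {J : I' → Option P} (h : IsReducedForm a r J)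
    (hR : ∀ i j, (R i j).Represents x σ (r i j)) :
    Runs x (kernelVectors R J : Fragment K ι κ _) σ (Fintype.card P * Fintype.card P) fun E σ' =>
      ∃ N : P → P → K, (∀ p q, (E p q).Represents x σ' (N p q)) ∧
        IsKernelBasis a (freeColumns J) N := by
  classical
  let N : P → P → K := fun p q =>
    if q = p then 1 else if h : ∃ i, J i = some q then 0 - r h.choose p else 0
  have hN : IsKernelBasis a (freeColumns J) N := by
    refine h.isKernelBasis (fun p => by simp [freeColumns]) (fun p => by simp [N]) ?_ ?_
    · intro p q i hq hi
      have hex : ∃ i, J i = some q := ⟨i, hi⟩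
      have : hex.choose = i := by
        by_contra hne
        have h1 := h.pivot_ne i q hi _ hne
        rw [h.pivot_self _ q hex.choose_spec] at h1
        exact one_ne_zero h1
      simp only [N, if_neg hq, dif_pos hex, this, zero_sub]
    · intro p q hq hi
      have hex : ¬ ∃ i, J i = some q := fun ⟨i, h⟩ => hi i h
      simp only [N, if_neg hq, dif_neg hex]
  refine Runs.mono (Runs.bind (runs_traverse (t := 1)
    (Q := fun pq o σ' => Operand.Represents x σ' o (N pq.1 pq.2))
    (fun ij r σ₁ σ₂ h hr => Operand.Represents.mono hr h)
    (fun pq σ' hσ' => ?_))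
    (fun E σ' _ hE => runs_ret ⟨N, fun p q => hE (p, q), hN⟩)) ?_ fun _ _ _ h => h
  · by_cases h1 : pq.2 = pq.1
    · rw [if_pos h1]
      refine (runs_ret ?_).mono zero_le_one fun _ _ _ h => h
      simp only [N, if_pos h1]
      exact Operand.represents_const 1
    · rw [if_neg h1]
      by_cases h2 : ∃ i, J i = some pq.2
      · rw [dif_pos h2]
        simp only [N, if_neg h1, dif_pos h2]
        exact runs_arith (Operand.represents_const 0) ((hR _ _).mono hσ') rfl
      · rw [dif_neg h2]
        refine (runs_ret ?_).mono zero_le_one fun _ _ _ h => h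
        simp only [N, if_neg h1, dif_neg h2]
        exact Operand.represents_const 0
  · rw [Fintype.card_prod]; push_cast; linarith

/-- The rows of `A`, placed at the indices `e i`; the entries of the other rows are `z`. -/
noncomputable def padRows {β : Type*} (e : I → I') (z : β) (A : I → P → β) : Matrix I' P β :=
  fun i' j => Function.extend e (fun i => A i j) (fun _ => z) i'

theorem mulVec_padRows_eq_zero_iff {e : I → I'} (he : Function.Injective e) (a : Matrix I P K)
    (y : P → K) : (padRows e 0 a).mulVec y = 0 ↔ a.mulVec y = 0 := by
  have h1 : ∀ i, (padRows e 0 a).mulVec y (e i) = a.mulVec y i := fun i =>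
    Finset.sum_congr rfl fun j _ => by
      change Function.extend e (fun i => a i j) (fun _ => 0) (e i) * y j = _
      rw [he.extend_apply]
  refine ⟨fun h => funext fun i => (h1 i).symm.trans (congrFun h (e i)), fun h => ?_⟩
  ext i'
  by_cases hi : ∃ i, e i = i'
  · obtain ⟨i, rfl⟩ := hi
    rw [h1, h]; rfl
  · exact Finset.sum_eq_zero fun j _ => by
      change Function.extend e (fun i => a i j) (fun _ => 0) i' * y j = _
      rw [Function.extend_apply' _ _ _ hi, zero_mul]

end Fragment

/-- A basis of the kernel of a matrix with at most `n` rows and at most `n` columns is computed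
within `C * n ^ ω` operations. -/
theorem exists_fragment_kernelBasis (ω c : ℝ) (hω : 2 < ω) :
    ∃ C : ℝ, 0 ≤ C ∧ ∀ (K : Type u) [Field K], MatMulCostBound K ω c →
      ∀ (ι κ I P : Type) [Fintype I] [Fintype P] (n : ℕ), 1 ≤ n → Fintype.card I ≤ n →
        Fintype.card P ≤ n →
      ∃ F : (I → P → Operand K ι) → Fragment K ι κ (Finset P × (P → P → Operand K ι)),
        ∀ (x : ι → K) (σ : MachineState K) (A : I → P → Operand K ι) (a : Matrix I P K),
          (∀ i j, (A i j).Represents x σ (a i j)) →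
          (F A).Runs x σ (C * (n : ℝ) ^ ω) fun B σ' => ∃ N : P → P → K,
            (∀ p q, (B.2 p q).Represents x σ' (N p q)) ∧ IsKernelBasis a B.1 N := by
  set r : ℝ := (2 : ℝ) ^ (ω - 2) with hr
  have hr1 : 1 < r := Real.one_lt_rpow (by norm_num) (by linarith)
  have hr0 : 0 < r - 1 := by linarith
  have hK : 0 ≤ 2 + (1 + |c|) / (r - 1) := by positivity
  refine ⟨(2 : ℝ) ^ ω * (2 + (1 + |c|) / (r - 1)) + 1, by positivity, ?_⟩
  intro K _ hmul ι κ I P _ _ n hn hI hP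
  choose p hp using hmul
  have hp' : ∀ s, ∀ A B : Matrix (Fin s) (Fin s) K, ∃ t : ℕ,
      (p s).exec (Sum.elim (fun ij => A ij.1 ij.2) (fun ij => B ij.1 ij.2)) =
          some (fun ij => (A * B) ij.1 ij.2, t) ∧ (t : ℝ) ≤ |c| * (s : ℝ) ^ ω := by
    intro s A B
    obtain ⟨t, h1, h2⟩ := hp s A B
    exact ⟨t, h1, h2.trans (mul_le_mul_of_nonneg_right (le_abs_self c) (by positivity))⟩
  -- the rows are filled up to a power of two
  obtain ⟨T, hT, hT'⟩ : ∃ T : ℕ, n ≤ 2 ^ T ∧ 2 ^ T ≤ 2 * n := by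
    refine ⟨Nat.log 2 n + 1, (Nat.lt_pow_succ_log_self one_lt_two n).le, ?_⟩
    have := Nat.pow_log_le_self 2 (x := n) (by omega)
    rw [pow_succ]; omega
  -- at depth `t` the columns are arranged in `2 ^ (T - t)` blocks of width `2 ^ t`
  have hemb : ∀ t, ∃ e : P → Fin (2 ^ (T - t)) × Fin (2 ^ t), Function.Injective e := by
    intro t
    have : Fintype.card P ≤ Fintype.card (Fin (2 ^ (T - t)) × Fin (2 ^ t)) := by
      rw [Fintype.card_prod, Fintype.card_fin, Fintype.card_fin, ← pow_add]
      exact (hP.trans hT).trans (Nat.pow_le_pow_right (by norm_num) (by omega))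
    obtain ⟨e⟩ := Function.Embedding.nonempty_of_card_le this
    exact ⟨e, e.injective⟩
  choose eP heP using hemb
  obtain ⟨e⟩ : Nonempty (I ↪ BlockIndex T) :=
    Function.Embedding.nonempty_of_card_le (by rw [BlockIndex.card]; exact hI.trans hT)
  refine ⟨fun A => (Fragment.rowReduce p eP T
      (Fragment.padRows e (.const 0) A)).bind fun R =>
    (Fragment.kernelVectors R.1 R.2).bind fun E => .ret (Fragment.freeColumns R.2, E), ?_⟩
  intro x σ A a hA
  have hA' : ∀ i j, (Fragment.padRows e (.const 0) A i j).Represents x σ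
      (Fragment.padRows e 0 a i j) := fun i j =>
    Fragment.extend_represents e.injective (fun i => hA i j) i
  refine Fragment.Runs.mono (Fragment.Runs.bind
    (Fragment.runs_rowReduce hp' T (fun i _ => heP i) hA') fun R σ₁ h₁ hR => ?_)
    (t₂ := ((2 : ℝ) ^ ω * (2 + (1 + |c|) / (r - 1)) + 1) * (n : ℝ) ^ ω)
    (t₁ := _ + (Fintype.card P * Fintype.card P + 0)) ?_ fun _ _ _ h => h
  · obtain ⟨r', hr', hred⟩ := hR
    have hred' : IsReducedForm a r' R.2 := by
      refine ⟨fun y => ?_, hred.row_eq_zero, hred.pivot_self, hred.pivot_ne⟩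
      rw [← hred.ker, Fragment.mulVec_padRows_eq_zero_iff e.injective]
    exact Fragment.Runs.bind (Fragment.runs_kernelVectors hred' hr') fun E σ₂ h₂ hE =>
      Fragment.runs_ret hE
  · have hcard : (Fintype.card P : ℝ) ≤ n := by exact_mod_cast hP
    have hn1 : (1 : ℝ) ≤ n := by exact_mod_cast hn
    have h1 := Fragment.rowReduceCost_le (c := |c|) hω (N := Fintype.card P) (T := T)
      (by exact_mod_cast hP.trans hT) le_rfl
    have h2 : ∑ i ∈ Finset.range T, r ^ i ≤ r ^ T / (r - 1) := by
      rw [geom_sum_eq hr1.ne']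
      gcongr
      linarith
    have h3 : (1 : ℝ) ≤ r ^ T := one_le_pow₀ hr1.le
    have h4 : (2 : ℝ) ^ T * 2 ^ T * r ^ T ≤ 2 ^ ω * (n : ℝ) ^ ω := by
      have h5 : (2 : ℝ) * 2 * r = 2 ^ ω := by
        rw [hr, Real.rpow_sub (by norm_num)]; norm_num; ring
      rw [← mul_pow, ← mul_pow, h5, ← Real.mul_rpow (by norm_num) (by positivity),
        ← Real.rpow_natCast, ← Real.rpow_mul (by norm_num), mul_comm ω, Real.rpow_mul (by norm_num),
        Real.rpow_natCast]
      exact Real.rpow_le_rpow (by positivity) (by exact_mod_cast hT') (by linarith)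
    have h6 : (Fintype.card P : ℝ) * Fintype.card P ≤ (n : ℝ) ^ ω := by
      have : (n : ℝ) ^ (2 : ℝ) ≤ (n : ℝ) ^ ω := Real.rpow_le_rpow_of_exponent_le hn1 hω.le
      refine le_trans ?_ this
      rw [Real.rpow_two, sq]
      exact mul_le_mul hcard hcard (by positivity) (by positivity)
    have h7 : 2 + (1 + |c|) * ∑ i ∈ Finset.range T, r ^ i
        ≤ r ^ T * (2 + (1 + |c|) / (r - 1)) := by
      have : (1 + |c|) * ∑ i ∈ Finset.range T, r ^ i ≤ (1 + |c|) * (r ^ T / (r - 1)) :=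
        mul_le_mul_of_nonneg_left h2 (by positivity)
      have e : (1 + |c|) * (r ^ T / (r - 1)) = r ^ T * ((1 + |c|) / (r - 1)) := by ring
      rw [e] at this
      linarith
    have h8 := h1.trans (mul_le_mul_of_nonneg_left h7 (by positivity))
    have h9 := mul_le_mul_of_nonneg_right h4 hK
    nlinarith [h8, h9, h6]

/-! ### Eliminants of systems of bounded size -/

section BoxPolynomial

open MvPolynomial

variable {R S : Type*} [CommSemiring R] [CommSemiring S] {ℓ m : ℕ}

/-- The exponent vector with the given entries. -/
noncomputable def boxExponent (α : Fin ℓ → Fin m) : Fin ℓ →₀ ℕ :=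
  Finsupp.equivFunOnFinite.symm fun i => (α i : ℕ)

theorem boxExponent_injective : Function.Injective (boxExponent : (Fin ℓ → Fin m) → Fin ℓ →₀ ℕ) :=
  fun _ _ h => funext fun i => Fin.ext (DFunLike.congr_fun h i)

theorem exists_boxExponent_eq {γ : Fin ℓ →₀ ℕ} (h : ∀ i, γ i < m) :
    ∃ α : Fin ℓ → Fin m, boxExponent α = γ :=
  ⟨fun i => ⟨γ i, h i⟩, Finsupp.ext fun _ => rfl⟩

/-- The polynomial with the given coefficients, in which all variables have exponents below `m`. -/
noncomputable def boxPoly (v : (Fin ℓ → Fin m) → R) : MvPolynomial (Fin ℓ) R :=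
  ∑ α, monomial (boxExponent α) (v α)

theorem coeff_boxPoly (v : (Fin ℓ → Fin m) → R) (α : Fin ℓ → Fin m) :
    coeff (boxExponent α) (boxPoly v) = v α := by
  classical
  rw [boxPoly, coeff_sum, Finset.sum_eq_single α]
  · rw [coeff_monomial, if_pos rfl]
  · intro β _ hβ
    rw [coeff_monomial, if_neg fun h => hβ (boxExponent_injective h)]
  · simp

theorem exists_of_mem_support_boxPoly {v : (Fin ℓ → Fin m) → R} {γ : Fin ℓ →₀ ℕ}
    (h : γ ∈ (boxPoly v).support) : ∃ α, boxExponent α = γ ∧ v α ≠ 0 := by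
  classical
  obtain ⟨α, -, hα⟩ := Finset.mem_biUnion.1 (support_sum h)
  rw [support_monomial] at hα
  split_ifs at hα with h0
  · simp at hα
  · exact ⟨α, (Finset.mem_singleton.1 hα).symm, h0⟩

theorem map_boxPoly (f : R →+* S) (v : (Fin ℓ → Fin m) → R) :
    map f (boxPoly v) = boxPoly fun α => f (v α) := by
  simp [boxPoly, map_monomial]

theorem eval₂_boxPoly (f : R →+* S) (y : Fin ℓ → S) (v : (Fin ℓ → Fin m) → R) :
    eval₂ f y (boxPoly v) = ∑ α, f (v α) * ∏ i, y i ^ (α i : ℕ) := by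
  rw [boxPoly, eval₂_sum]
  refine Finset.sum_congr rfl fun α _ => ?_
  rw [eval₂_monomial, Finsupp.prod_fintype _ _ fun i => pow_zero _]
  rfl

theorem degreeOf_boxPoly_le (v : (Fin ℓ → Fin (m + 1)) → R) (i : Fin ℓ) :
    degreeOf i (boxPoly v) ≤ m := by
  rw [degreeOf_le_iff]
  intro γ hγ
  obtain ⟨α, rfl, -⟩ := exists_of_mem_support_boxPoly hγ
  exact Nat.lt_succ_iff.1 (α i).2

theorem boxPoly_coeff_eq (p : MvPolynomial (Fin ℓ) R) (h : ∀ i, degreeOf i p ≤ m) :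
    (boxPoly fun α : Fin ℓ → Fin (m + 1) => coeff (boxExponent α) p) = p := by
  classical
  ext γ
  by_cases hγ : ∀ i, γ i < m + 1
  · obtain ⟨α, rfl⟩ := exists_boxExponent_eq hγ
    rw [coeff_boxPoly]
  · have h1 : γ ∉ p.support := fun hm => hγ fun i =>
      Nat.lt_succ_of_le (degreeOf_le_iff.1 (h i) γ hm)
    rw [notMem_support_iff.1 h1]
    by_contra h2
    obtain ⟨α, rfl, -⟩ := exists_of_mem_support_boxPoly (mem_support_iff.2 h2)
    exact hγ fun i => (α i).2

theorem degreeOf_mul_prod_pow_le {D : ℕ} (p : Option (Fin ℓ) → MvPolynomial (Fin ℓ) R)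
    (hp : ∀ j i, degreeOf i (p j) ≤ m) (e : Fin (D + 1) × (Fin ℓ → Fin (D + 1))) (i : Fin ℓ) :
    degreeOf i (p none ^ (e.1 : ℕ) * ∏ j, p (some j) ^ (e.2 j : ℕ)) ≤ m * (ℓ + 1) * D := by
  have h1 : ∀ j (n : Fin (D + 1)), degreeOf i (p j ^ (n : ℕ)) ≤ D * m := fun j n =>
    (degreeOf_pow_le _ _ _).trans (Nat.mul_le_mul (Nat.lt_succ_iff.1 n.2) (hp j i))
  refine (degreeOf_mul_le _ _ _).trans ?_
  refine (Nat.add_le_add (h1 _ _) ((degreeOf_prod_le _ _ _).trans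
    (Finset.sum_le_card_nsmul _ _ (D * m) fun j _ => h1 _ _))).trans ?_
  rw [Finset.card_univ, Fintype.card_fin, smul_eq_mul]
  apply le_of_eq; ring

end BoxPolynomial

section Relation

open MvPolynomial

/-- A relation between `g` and the polynomials `h i`, as many as there are variables and with
finitely many common zeros, whose part of lowest degree in the `h i` contains the monomial `t`: the
coefficient of that monomial, a univariate polynomial, vanishes at the values of `g` at the common
zeros. -/
theorem aeval_polyOfCoeffs_eq_zero_of_relation {K : Type u} [Field K] {ℓ D : ℕ}
    (g : MvPolynomial (Fin ℓ) K) (h : Fin ℓ → MvPolynomial (Fin ℓ) K)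
    (hfin : {b : Fin ℓ → AlgebraicClosure K | ∀ i, aeval b (h i) = 0}.Finite)
    (v : Fin (D + 1) × (Fin ℓ → Fin (D + 1)) → K)
    (hrel : ∑ e, v e • (g ^ (e.1 : ℕ) * ∏ i, h i ^ (e.2 i : ℕ)) = 0)
    (t : Fin ℓ → Fin (D + 1))
    (ht : ∀ e, v e ≠ 0 → ∑ i, (t i : ℕ) ≤ ∑ i, (e.2 i : ℕ))
    (b : Fin ℓ → AlgebraicClosure K) (hb : ∀ i, aeval b (h i) = 0) :
    Polynomial.aeval (aeval b g) (polyOfCoeffs fun j => v (j, t)) = 0 := by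
  set φ := algebraMap K (AlgebraicClosure K) with hφ
  have hev : ∀ (b : Fin ℓ → AlgebraicClosure K) (p : MvPolynomial (Fin ℓ) K),
      eval b (map φ p) = aeval b p := fun b p => by rw [eval_map, aeval_def]
  have key := eval_coeff_eq_zero_of_relation (fun i => map φ (h i)) (map φ g)
    (by simpa only [hev] using hfin)
    (boxPoly fun t => polyOfCoeffs fun j => φ (v (j, t))) ?_ (boxExponent t) ?_ b
    (by simpa only [hev] using hb)
  · rw [coeff_boxPoly, hev] at key
    rw [← key, polyOfCoeffs, polyOfCoeffs, map_sum, Polynomial.eval_finsetSum]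
    refine Finset.sum_congr rfl fun j _ => ?_
    rw [Polynomial.aeval_monomial, Polynomial.eval_monomial]
  · rw [eval₂_boxPoly]
    have := congrArg (map φ) hrel
    rw [map_zero, map_sum, Fintype.sum_prod_type, Finset.sum_comm] at this
    rw [← this]
    refine Finset.sum_congr rfl fun t _ => ?_
    change Polynomial.aeval _ (polyOfCoeffs _) * _ = _
    rw [polyOfCoeffs, map_sum, Finset.sum_mul]
    refine Finset.sum_congr rfl fun j _ => ?_
    rw [Polynomial.aeval_monomial, smul_eq_C_mul, map_mul, map_C, map_mul, map_prod, map_pow,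
      mul_assoc]
    simp only [map_pow]
    rfl
  · intro γ hγ
    obtain ⟨t', rfl, ht'⟩ := exists_of_mem_support_boxPoly hγ
    rw [Finsupp.degree_eq_sum, Finsupp.degree_eq_sum]
    obtain ⟨j, hj⟩ : ∃ j, v (j, t') ≠ 0 := by
      by_contra hcon
      push Not at hcon
      exact ht' (by simp [polyOfCoeffs, hcon])
    exact ht _ hj

theorem polyOfCoeffs_ne_zero {K : Type u} [Field K] {d : ℕ} {y : Fin d → K} {j : Fin d}
    (hj : y j ≠ 0) : polyOfCoeffs y ≠ 0 := by
  intro h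
  apply hj
  have := congrArg (fun p => Polynomial.coeff p j) h
  simp only [polyOfCoeffs, Polynomial.finsetSum_coeff, Polynomial.coeff_monomial,
    Polynomial.coeff_zero] at this
  rw [Finset.sum_eq_single j] at this
  · simpa using this
  · intro i _ hi
    rw [if_neg fun h => hi (Fin.ext h)]
  · simp

end Relation

/-- A polynomial with integer coefficients is evaluated within a number of operations that does not
depend on the field. -/
theorem exists_fragment_aeval {J : Type} (g : MvPolynomial J ℤ) :
    ∃ C : ℝ, 0 ≤ C ∧ ∀ (K : Type u) [Field K] (ι κ : Type) (A : J → Operand K ι),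
      ∃ F : Fragment K ι κ (Operand K ι), ∀ (x : ι → K) (σ : MachineState K) (v : J → K),
        (∀ j, (A j).Represents x σ (v j)) →
        F.Runs x σ C fun o σ' => o.Represents x σ' (MvPolynomial.aeval v g) := by
  induction g using MvPolynomial.induction_on with
  | C a =>
    refine ⟨0, le_rfl, fun K _ ι κ A => ⟨.ret (.const (a : K)), fun x σ v hA => ?_⟩⟩
    refine Fragment.runs_ret ?_
    rw [MvPolynomial.aeval_C]
    exact Operand.represents_const _
  | add p q hp hq =>
    obtain ⟨C₁, h₁, hp⟩ := hp
    obtain ⟨C₂, h₂, hq⟩ := hq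
    refine ⟨C₁ + (C₂ + 1), by positivity, fun K _ ι κ A => ?_⟩
    obtain ⟨F, hF⟩ := hp K ι κ A
    obtain ⟨G, hG⟩ := hq K ι κ A
    refine ⟨F.bind fun a => G.bind fun b => .arith .add a b, fun x σ v hA => ?_⟩
    refine (hF x σ v hA).bind fun a σ₁ h₁ ha =>
      (hG x σ₁ v fun j => (hA j).mono h₁).bind fun b σ₂ h₂ hb => ?_
    exact Fragment.runs_arith (ha.mono h₂) hb (by rw [map_add]; rfl)
  | mul_X p j hp =>
    obtain ⟨C₁, h₁, hp⟩ := hp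
    refine ⟨C₁ + 1, by positivity, fun K _ ι κ A => ?_⟩
    obtain ⟨F, hF⟩ := hp K ι κ A
    refine ⟨F.bind fun a => .arith .mul a (A j), fun x σ v hA => ?_⟩
    refine (hF x σ v hA).bind fun a σ₁ h₁ ha => ?_
    exact Fragment.runs_arith ha ((hA j).mono h₁) (by rw [map_mul, MvPolynomial.aeval_X]; rfl)

/-- Finitely many polynomials with integer coefficients are evaluated within a number of operations
that does not depend on the field. -/
theorem exists_fragment_aeval_family {J I : Type} [Fintype I] (g : I → MvPolynomial J ℤ) :
    ∃ C : ℝ, 0 ≤ C ∧ ∀ (K : Type u) [Field K] (ι κ : Type) (A : J → Operand K ι),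
      ∃ F : Fragment K ι κ (I → Operand K ι), ∀ (x : ι → K) (σ : MachineState K) (v : J → K),
        (∀ j, (A j).Represents x σ (v j)) →
        F.Runs x σ C fun o σ' => ∀ i, (o i).Represents x σ' (MvPolynomial.aeval v (g i)) := by
  choose C hC h using fun i => exists_fragment_aeval.{u} (g i)
  refine ⟨Fintype.card I * ∑ i, C i, mul_nonneg (Nat.cast_nonneg _)
    (Finset.sum_nonneg fun i _ => hC i), fun K _ ι κ A => ?_⟩
  choose F hF using fun i => h i K ι κ A
  refine ⟨Fragment.traverse F, fun x σ v hA => Fragment.runs_traverse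
    (Q := fun i o σ' => Operand.Represents x σ' o (MvPolynomial.aeval v (g i)))
    (fun i o σ₁ σ₂ h ho => Operand.Represents.mono ho h) fun i σ' hσ' => ?_⟩
  exact (hF i x σ' v fun j => (hA j).mono hσ').mono
    (Finset.single_le_sum (fun i _ => hC i) (Finset.mem_univ i)) fun _ _ _ h => h

/-- For systems of `ℓ` polynomials `p (some i)` in `ℓ` variables with exponents at most two and with
finitely many zeros, a univariate polynomial that vanishes at the values of `p none` at the zeros is
computed within a number of operations that depends only on `ℓ`, `ω` and `c`.

There are more monomials of degree at most `D` in each of `ℓ + 1` indeterminates than there are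
monomials in the polynomials obtained by substituting the `p j` for the indeterminates, if `D` is at
least `(2 * (ℓ + 1)) ^ ℓ`. So there is a relation between the `p j`, which is found as a vector in
the kernel of a matrix of bounded size. -/
theorem exists_fragment_eliminant (ω c : ℝ) (hω : 2 < ω) (ℓ : ℕ) :
    ∃ (C : ℝ) (d : ℕ), 0 ≤ C ∧ ∀ (K : Type u) [Field K], MatMulCostBound K ω c → ∀ (ι κ : Type)
      (A : Option (Fin ℓ) → (Fin ℓ → Fin 3) → Operand K ι),
      ∃ F : Fragment K ι κ (Fin d → Operand K ι),
        ∀ (x : ι → K) (σ : MachineState K) (v : Option (Fin ℓ) → (Fin ℓ → Fin 3) → K),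
          (∀ j α, (A j α).Represents x σ (v j α)) →
          {b : Fin ℓ → AlgebraicClosure K |
            ∀ i, MvPolynomial.aeval b (boxPoly (v (some i))) = 0}.Finite →
          F.Runs x σ C fun o σ' => ∃ y : Fin d → K, (∀ j, (o j).Represents x σ' (y j)) ∧
            polyOfCoeffs y ≠ 0 ∧ ∀ b : Fin ℓ → AlgebraicClosure K,
              (∀ i, MvPolynomial.aeval b (boxPoly (v (some i))) = 0) →
              Polynomial.aeval (MvPolynomial.aeval b (boxPoly (v none))) (polyOfCoeffs y) = 0 := by
  classical
  set D : ℕ := (2 * (ℓ + 1)) ^ ℓ with hD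
  let P : Type := Fin (D + 1) × (Fin ℓ → Fin (D + 1))
  let I : Type := Fin ℓ → Fin (2 * (ℓ + 1) * D + 1)
  have hcard : Fintype.card I < Fintype.card P := by
    simp only [I, P, Fintype.card_prod, Fintype.card_fun, Fintype.card_fin]
    calc (2 * (ℓ + 1) * D + 1) ^ ℓ ≤ (2 * (ℓ + 1) * (D + 1)) ^ ℓ := by
          apply Nat.pow_le_pow_left
          rw [mul_add (2 * (ℓ + 1)) D 1]; omega
      _ = D * (D + 1) ^ ℓ := by rw [mul_pow, hD]
      _ < (D + 1) * (D + 1) ^ ℓ := by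
          apply Nat.mul_lt_mul_of_pos_right (Nat.lt_succ_self D)
          positivity
  let U : Option (Fin ℓ) → MvPolynomial (Fin ℓ)
      (MvPolynomial (Option (Fin ℓ) × (Fin ℓ → Fin 3)) ℤ) :=
    fun j => boxPoly fun α => MvPolynomial.X (j, α)
  let g : I × P → MvPolynomial (Option (Fin ℓ) × (Fin ℓ → Fin 3)) ℤ := fun e =>
    MvPolynomial.coeff (boxExponent e.1)
      (U none ^ (e.2.1 : ℕ) * ∏ j, U (some j) ^ (e.2.2 j : ℕ))
  obtain ⟨C₁, hC₁, h₁⟩ := exists_fragment_aeval_family.{u} g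
  obtain ⟨C₂, hC₂, h₂⟩ := exists_fragment_kernelBasis.{u} ω c hω
  refine ⟨C₁ + (C₂ * (Fintype.card P : ℝ) ^ ω + Fintype.card P), D + 1, by positivity, ?_⟩
  intro K _ hmul ι κ A
  obtain ⟨F₁, hF₁⟩ := h₁ K ι κ fun e => A e.1 e.2
  obtain ⟨F₂, hF₂⟩ := h₂ K hmul ι κ I P (Fintype.card P) (by omega) hcard.le le_rfl
  -- the vector of the kernel basis that is used, and the monomial of lowest degree in it
  let pick : Finset P → P := fun s => if h : s.Nonempty then h.choose else (0, fun _ => 0)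
  let low : Finset P → (Fin ℓ → Fin (D + 1)) := fun s =>
    if h : s.Nonempty then
      (s.exists_min_image (fun e => ∑ i, (e.2 i : ℕ)) h).choose.2
    else fun _ => 0
  refine ⟨F₁.bind fun a => (F₂ fun i e => a (i, e)).bind fun B =>
    (Fragment.nonzeroSet (B.2 (pick B.1))).bind fun s =>
      .ret fun j => B.2 (pick B.1) (j, low s), ?_⟩
  intro x σ v hA hfin
  let p : Option (Fin ℓ) → MvPolynomial (Fin ℓ) K := fun j => boxPoly (v j)
  let a : Matrix I P K := fun i e =>
    MvPolynomial.coeff (boxExponent i) (p none ^ (e.1 : ℕ) * ∏ j, p (some j) ^ (e.2 j : ℕ))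
  have ha : ∀ i e, MvPolynomial.aeval (fun e => v e.1 e.2) (g (i, e)) = a i e := by
    intro i e
    let ψ : MvPolynomial (Option (Fin ℓ) × (Fin ℓ → Fin 3)) ℤ →+* K :=
      (MvPolynomial.aeval fun e => v e.1 e.2 :
        MvPolynomial (Option (Fin ℓ) × (Fin ℓ → Fin 3)) ℤ →ₐ[ℤ] K).toRingHom
    have hU : ∀ j, MvPolynomial.map ψ (U j) = p j := fun j => by
      simp only [U, map_boxPoly, p]
      congr 1
      funext α
      exact MvPolynomial.aeval_X _ _
    change ψ (g (i, e)) = _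
    simp only [g, a]
    rw [← MvPolynomial.coeff_map, map_mul, map_prod]
    simp only [map_pow, hU]
  refine Fragment.Runs.mono (Fragment.Runs.bind (hF₁ x σ (fun e => v e.1 e.2) fun e => hA e.1 e.2)
    fun a' σ₁ h₁ ha' => Fragment.Runs.bind (hF₂ x σ₁ (fun i e => a' (i, e)) a fun i e => by
      rw [← ha]; exact ha' (i, e)) fun B σ₂ h₂ hB => ?_) (t₁ := C₁ + (C₂ * (Fintype.card P : ℝ) ^ ω
        + (Fintype.card P + 0))) (by linarith) fun _ _ _ h => h
  obtain ⟨N, hN, hbasis⟩ := hB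
  -- there are more unknowns than equations
  have hne : B.1.Nonempty := by
    rw [← Finset.card_pos]
    have h1 := hbasis.card_add_rank
    have h2 := a.rank_le_card_height
    omega
  have hpick : pick B.1 ∈ B.1 := by
    simp only [pick, dif_pos hne]
    exact hne.choose_spec
  set w : P → K := N (pick B.1) with hw
  have hker := hbasis.mulVec_eq_zero _ hpick
  have hrel : ∑ e : P, w e • (p none ^ (e.1 : ℕ) * ∏ i, p (some i) ^ (e.2 i : ℕ)) = 0 := by
    rw [← boxPoly_coeff_eq (m := 2 * (ℓ + 1) * D)
      (∑ e : P, w e • (p none ^ (e.1 : ℕ) * ∏ i, p (some i) ^ (e.2 i : ℕ)))]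
    · refine Finset.sum_eq_zero fun i _ => ?_
      beta_reduce
      rw [MvPolynomial.coeff_sum]
      have := congrFun hker i
      have h0 : ∑ e : P, a i e * w e = 0 := this
      rw [show ∑ e : P, MvPolynomial.coeff (boxExponent i)
        (w e • (p none ^ (e.1 : ℕ) * ∏ i, p (some i) ^ (e.2 i : ℕ))) = ∑ e : P, a i e * w e from
        Finset.sum_congr rfl fun e _ => by
          rw [MvPolynomial.coeff_smul, smul_eq_mul, mul_comm], h0, MvPolynomial.monomial_zero]
    · intro i
      refine (MvPolynomial.degreeOf_sum_le _ _ _).trans (Finset.sup_le fun e _ => ?_)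
      rw [MvPolynomial.smul_eq_C_mul]
      refine (MvPolynomial.degreeOf_C_mul_le _ _ _).trans ?_
      exact degreeOf_mul_prod_pow_le p (fun j i => degreeOf_boxPoly_le _ i) e i
  refine Fragment.Runs.bind (Fragment.runs_nonzeroSet fun e => hN (pick B.1) e)
    fun s σ₃ h₃ hs => Fragment.runs_ret ?_
  have hsne : s.Nonempty := ⟨pick B.1, (hs _).2 (by rw [hbasis.apply_self]; exact one_ne_zero)⟩
  obtain ⟨e₀, he₀, hlow, hmin⟩ : ∃ e₀ ∈ s, e₀.2 = low s ∧
      ∀ e ∈ s, ∑ i, (low s i : ℕ) ≤ ∑ i, (e.2 i : ℕ) := by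
    simp only [low, dif_pos hsne]
    have := (s.exists_min_image (fun e => ∑ i, (e.2 i : ℕ)) hsne).choose_spec
    exact ⟨_, this.1, rfl, this.2⟩
  refine ⟨fun j => w (j, low s), fun j => (hN _ _).mono h₃, ?_, fun b hb => ?_⟩
  · refine polyOfCoeffs_ne_zero (j := e₀.1) ?_
    rw [← hlow]
    exact (hs e₀).1 he₀
  · exact aeval_polyOfCoeffs_eq_zero_of_relation (p none) (fun i => p (some i)) hfin w hrel (low s)
      (fun e he => hmin e ((hs e).2 he)) b hb

/-! ### Systems whose supports contain all the squares -/

section Supports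

open MvPolynomial

variable {n k ℓ : ℕ} {M : Finset (Fin n →₀ ℕ)}

theorem mem_isolatedVars {i : Fin n} :
    i ∈ isolatedVars M ↔ ∀ α ∈ M, IsSquareFreeMonomial α → α i = 0 := by
  simp [isolatedVars]

theorem IsAllSquaresSupport.eq_single_of_not_isSquareFreeMonomial (hM : IsAllSquaresSupport k M)
    {α : Fin n →₀ ℕ} (hα : α ∈ M) (hsq : ¬ IsSquareFreeMonomial α) :
    ∃ i, α = Finsupp.single i 2 := by
  classical
  simp only [IsSquareFreeMonomial, not_forall, not_le] at hsq
  obtain ⟨i, hi⟩ := hsq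
  refine ⟨i, ?_⟩
  have h1 := hM.degree_le α hα
  rw [Finsupp.degree_eq_sum, ← Finset.add_sum_erase _ _ (Finset.mem_univ i)] at h1
  have h2 : ∑ j ∈ Finset.univ.erase i, α j = 0 := by omega
  ext j
  by_cases hj : j = i
  · subst hj
    rw [Finsupp.single_eq_same]; omega
  · rw [Finsupp.single_eq_of_ne hj]
    exact Finset.sum_eq_zero_iff.1 h2 j (Finset.mem_erase.2 ⟨hj, Finset.mem_univ j⟩)

/-- Only `k` monomials of the support are neither `1` nor squares, and each of them contains at most
two variables. -/
theorem IsAllSquaresSupport.card_compl_isolatedVars_le (hM : IsAllSquaresSupport k M) :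
    (isolatedVars M)ᶜ.card ≤ 2 * k := by
  classical
  let Sq : Finset (Fin n →₀ ℕ) := Finset.univ.image fun i => Finsupp.single i 2
  have hSq : Sq.card = n := by
    rw [Finset.card_image_of_injective _ (Finsupp.single_left_injective (by norm_num)),
      Finset.card_univ, Fintype.card_fin]
  have hSqM : insert 0 Sq ⊆ M := by
    intro α hα
    rcases Finset.mem_insert.1 hα with rfl | hα
    · exact hM.one_mem
    · obtain ⟨i, -, rfl⟩ := Finset.mem_image.1 hα
      exact hM.square_mem i
  have h0 : (0 : Fin n →₀ ℕ) ∉ Sq := by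
    intro h
    obtain ⟨i, -, hi⟩ := Finset.mem_image.1 h
    have := DFunLike.congr_fun hi i
    simp at this
  have hcard : (M \ insert 0 Sq).card = k := by
    rw [Finset.card_sdiff_of_subset hSqM, Finset.card_insert_of_notMem h0, hSq, hM.card_eq]
    omega
  have hsub : (isolatedVars M)ᶜ ⊆ (M \ insert 0 Sq).biUnion fun α => α.support := by
    intro i hi
    rw [Finset.mem_compl, mem_isolatedVars] at hi
    push Not at hi
    obtain ⟨α, hα, hsq, hi⟩ := hi
    refine Finset.mem_biUnion.2 ⟨α, Finset.mem_sdiff.2 ⟨hα, fun h => ?_⟩, by simpa using hi⟩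
    rcases Finset.mem_insert.1 h with rfl | h
    · exact hi rfl
    · obtain ⟨j, -, rfl⟩ := Finset.mem_image.1 h
      have := hsq j
      simp at this
  refine (Finset.card_le_card hsub).trans ?_
  rw [← hcard, mul_comm]
  refine Finset.card_biUnion_le_card_mul _ _ _ fun α hα => ?_
  refine le_trans ?_ (hM.degree_le α (Finset.mem_sdiff.1 hα).1)
  rw [Finset.card_eq_sum_ones, Finsupp.degree]
  exact Finset.sum_le_sum fun i hi => Nat.one_le_iff_ne_zero.2 (Finsupp.mem_support_iff.1 hi)

/-- The exponent vector in `n` variables which has the entries of `α` at the variables `φ i`. -/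
noncomputable def liftExponent (φ : Fin ℓ → Fin n) (α : Fin ℓ → Fin 3) : Fin n →₀ ℕ :=
  (boxExponent α).mapDomain φ

/-- The part of a polynomial that contains only the variables `φ i`, each with exponents at most
two, as a polynomial in these variables. -/
noncomputable def restrictedPart {K : Type*} [CommSemiring K] (φ : Fin ℓ → Fin n)
    (f : MvPolynomial (Fin n) K) : MvPolynomial (Fin ℓ) K :=
  boxPoly fun α => coeff (liftExponent φ α) f

theorem IsAllSquaresSupport.exists_liftExponent_eq (hM : IsAllSquaresSupport k M)
    {φ : Fin ℓ → Fin n} (hφ : Function.Injective φ)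
    (hrange : ∀ i, i ∈ Set.range φ ↔ i ∉ isolatedVars M) {γ : Fin n →₀ ℕ} (hγ : γ ∈ M)
    (hne : ∀ i ∈ isolatedVars M, γ ≠ Finsupp.single i 2) : ∃ α, liftExponent φ α = γ := by
  have hdeg : ∀ i, γ i < 3 := fun i =>
    Nat.lt_succ_of_le ((Finsupp.le_degree i γ).trans (hM.degree_le γ hγ))
  have hzero : ∀ i, i ∉ Set.range φ → γ i = 0 := by
    intro i hi
    have hi' : i ∈ isolatedVars M := by
      by_contra h
      exact hi ((hrange i).2 h)
    by_cases hsq : IsSquareFreeMonomial γ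
    · exact mem_isolatedVars.1 hi' γ hγ hsq
    · obtain ⟨j, rfl⟩ := hM.eq_single_of_not_isSquareFreeMonomial hγ hsq
      rw [Finsupp.single_eq_of_ne]
      rintro rfl
      exact hne _ hi' rfl
  obtain ⟨α, hα⟩ := exists_boxExponent_eq (m := 3) (γ := γ.comapDomain φ hφ.injOn)
    fun i => hdeg (φ i)
  refine ⟨α, ?_⟩
  rw [liftExponent, hα, Finsupp.mapDomain_comapDomain _ hφ]
  intro i hi
  by_contra h
  exact (Finsupp.mem_support_iff.1 hi) (hzero i h)

/-- A polynomial with support in `M` is the sum of a polynomial in the variables that appear in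
square-free monomials and of a linear combination of the squares of the other variables. -/
theorem IsAllSquaresSupport.eq_rename_restrictedPart_add {K : Type*} [CommSemiring K]
    (hM : IsAllSquaresSupport k M) {φ : Fin ℓ → Fin n} (hφ : Function.Injective φ)
    (hrange : ∀ i, i ∈ Set.range φ ↔ i ∉ isolatedVars M) {f : MvPolynomial (Fin n) K}
    (hf : f.support ⊆ M) :
    f = rename φ (restrictedPart φ f) +
      ∑ i : isolatedVars M, monomial (Finsupp.single (i : Fin n) 2)
        (coeff (Finsupp.single (i : Fin n) 2) f) := by
  classical
  ext γ
  rw [coeff_add, coeff_sum]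
  simp only [coeff_monomial]
  by_cases hγ : ∃ α, liftExponent φ α = γ
  · obtain ⟨α, rfl⟩ := hγ
    rw [Finset.sum_eq_zero, add_zero, liftExponent, coeff_rename_mapDomain φ hφ, restrictedPart,
      coeff_boxPoly, liftExponent]
    intro i _
    rw [if_neg]
    intro h
    have h1 := DFunLike.congr_fun h (i : Fin n)
    rw [liftExponent, Finsupp.single_eq_same, Finsupp.mapDomain_of_notMem_range] at h1
    · exact two_ne_zero h1
    · exact fun h => (hrange _).1 h i.2
  · rw [coeff_rename_eq_zero, zero_add]
    · by_cases hsq : ∃ i : isolatedVars M, Finsupp.single (i : Fin n) 2 = γ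
      · obtain ⟨i, rfl⟩ := hsq
        rw [Finset.sum_eq_single i, if_pos rfl]
        · intro j _ hj
          rw [if_neg]
          intro h
          exact hj (Subtype.ext (Finsupp.single_left_injective (by norm_num) h))
        · simp
      · rw [Finset.sum_eq_zero]
        · rw [← notMem_support_iff]
          intro h
          exact hγ (hM.exists_liftExponent_eq hφ hrange (hf h)
            fun i hi he => hsq ⟨⟨i, hi⟩, he.symm⟩)
        · intro i _
          rw [if_neg fun h => hsq ⟨i, h⟩]
    · intro u hu
      by_contra h0
      obtain ⟨α, rfl, -⟩ := exists_of_mem_support_boxPoly (mem_support_iff.2 h0)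
      exact hγ ⟨α, hu⟩

end Supports

section Elimination

open MvPolynomial

variable {K : Type u} [Field K] {n k ℓ : ℕ} {M : Finset (Fin n →₀ ℕ)}

theorem aeval_eq_restrictedPart_add (hM : IsAllSquaresSupport k M) {φ : Fin ℓ → Fin n}
    (hφ : Function.Injective φ) (hrange : ∀ i, i ∈ Set.range φ ↔ i ∉ isolatedVars M)
    {L : Type*} [Field L] [Algebra K L] {f : MvPolynomial (Fin n) K} (hf : f.support ⊆ M)
    (a : Fin n → L) :
    aeval a f = aeval (fun i => a (φ i)) (restrictedPart φ f) +
      ∑ i : isolatedVars M, algebraMap K L (coeff (Finsupp.single (i : Fin n) 2) f) * a i ^ 2 := by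
  conv_lhs => rw [hM.eq_rename_restrictedPart_add hφ hrange hf]
  rw [map_add, aeval_rename, map_sum]
  congr 1
  refine Finset.sum_congr rfl fun i _ => ?_
  rw [aeval_monomial, Finsupp.prod_single_index]
  exact pow_zero _

/-- A matrix of full column rank has a left inverse. -/
theorem Matrix.exists_mul_eq_one_of_rank_eq_card {I J : Type*} [Fintype I] [Fintype J]
    [DecidableEq J] {S : Matrix I J K} (hS : S.rank = Fintype.card J) :
    ∃ B : Matrix J I K, B * S = 1 := by
  rw [← Matrix.vecMul_surjective_iff_exists_left_inverse]
  have h1 : LinearMap.range S.transpose.mulVecLin = ⊤ := by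
    apply Submodule.eq_top_of_finrank_eq
    rw [Module.finrank_fintype_fun_eq_card, ← hS, ← Matrix.rank_transpose]
    rfl
  intro y
  obtain ⟨x, hx⟩ := LinearMap.range_eq_top.1 h1 y
  exact ⟨x, (Matrix.mulVec_transpose S x).symm.trans hx⟩

/-- Let the linear combinations of the system with the vectors of a basis of the left kernel of `S`
vanish at a point in the remaining variables. Then the point extends to a solution: the squares of
the isolated variables solve a linear system with matrix `S` whose right-hand side is orthogonal to
the left kernel. -/
theorem exists_mem_solutionSet_of_isKernelBasis (hM : IsAllSquaresSupport k M)
    {φ : Fin ℓ → Fin n} (hφ : Function.Injective φ)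
    (hrange : ∀ i, i ∈ Set.range φ ↔ i ∉ isolatedVars M) {f : Fin n → MvPolynomial (Fin n) K}
    (hf : ∀ i, (f i).support ⊆ M)
    (hrank : (isolatedSquareMatrix M f).rank = (isolatedVars M).card) {s : Finset (Fin n)}
    {N : Fin n → Fin n → K} (hN : IsKernelBasis (isolatedSquareMatrix M f).transpose s N)
    (b : Fin ℓ → AlgebraicClosure K)
    (hb : ∀ p ∈ s, ∑ q, algebraMap K (AlgebraicClosure K) (N p q) *
      aeval b (restrictedPart φ (f q)) = 0) :
    ∃ a ∈ solutionSet f, (fun i => a (φ i)) = b := by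
  classical
  set S := isolatedSquareMatrix M f with hS
  set ψ := algebraMap K (AlgebraicClosure K) with hψ
  obtain ⟨B, hB⟩ := Matrix.exists_mul_eq_one_of_rank_eq_card
    (hrank.trans (Fintype.card_coe _).symm)
  let r : Fin n → AlgebraicClosure K := fun q => aeval b (restrictedPart φ (f q))
  -- a vector in the left kernel of `S` is orthogonal to `r`
  have horth : ∀ x : Fin n → K, S.transpose.mulVec x = 0 → ∑ q, ψ (x q) * r q = 0 := by
    intro x hx
    have h1 : ∀ q, ψ (x q) = ∑ p ∈ s, ψ (x p) * ψ (N p q) := by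
      intro q
      conv_lhs => rw [hN.eq_sum x hx]
      rw [Finset.sum_apply, map_sum]
      exact Finset.sum_congr rfl fun p _ => by rw [Pi.smul_apply, smul_eq_mul, map_mul]
    rw [Finset.sum_congr rfl fun q _ => by rw [h1 q, Finset.sum_mul], Finset.sum_comm]
    refine Finset.sum_eq_zero fun p hp => ?_
    rw [← mul_zero (ψ (x p)), ← hb p hp, Finset.mul_sum]
    exact Finset.sum_congr rfl fun q _ => mul_assoc _ _ _
  have hSB : ∀ q, ∑ q', ψ ((S * B) q q') * r q' = r q := by
    intro q
    let A : Matrix (Fin n) (Fin n) K := 1 - S * B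
    have hA : A * S = 0 := by
      rw [Matrix.sub_mul, Matrix.one_mul, Matrix.mul_assoc, hB, Matrix.mul_one, sub_self]
    have h1 := horth (A q) (by
      rw [Matrix.mulVec_transpose, ← Matrix.mul_apply_eq_vecMul, hA]
      rfl)
    simp only [A, Matrix.sub_apply, map_sub, sub_mul, Finset.sum_sub_distrib] at h1
    rw [Finset.sum_eq_single q] at h1
    · rw [Matrix.one_apply_eq, map_one, one_mul] at h1
      exact (sub_eq_zero.1 h1).symm
    · intro q' _ hq'
      rw [Matrix.one_apply_ne hq'.symm, map_zero, zero_mul]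
    · simp
  choose w hw using fun i : isolatedVars M =>
    IsAlgClosed.exists_pow_nat_eq (- ∑ q', ψ (B i q') * r q') (n := 2) two_pos
  let a : Fin n → AlgebraicClosure K := fun i =>
    if h : i ∈ isolatedVars M then w ⟨i, h⟩ else Function.extend φ b 0 i
  have ha : (fun i => a (φ i)) = b := by
    funext i
    have : φ i ∉ isolatedVars M := (hrange _).1 ⟨i, rfl⟩
    simp only [a, dif_neg this, hφ.extend_apply]
  refine ⟨a, fun q => ?_, ha⟩
  rw [aeval_eq_restrictedPart_add hM hφ hrange (hf q), ha]
  have hw' : ∀ i : isolatedVars M, a i ^ 2 = - ∑ q', ψ (B i q') * r q' := fun i => by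
    simp only [a, dif_pos i.2]
    exact hw i
  have hsum : ∑ i : isolatedVars M, ψ (S q i) * a i ^ 2 = - r q := by
    rw [← hSB q]
    simp only [hw', mul_neg, Finset.sum_neg_distrib, Finset.mul_sum]
    rw [Finset.sum_comm]
    congr 1
    refine Finset.sum_congr rfl fun q' _ => ?_
    rw [Matrix.mul_apply, map_sum, Finset.sum_mul]
    exact Finset.sum_congr rfl fun i _ => by rw [map_mul, mul_assoc]
  change r q + ∑ i : isolatedVars M, ψ (S q i) * a i ^ 2 = 0
  rw [hsum, add_neg_cancel]

/-- At a solution, the linear combinations of the system with vectors in the left kernel of `S`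
vanish, and they do not involve the isolated variables. -/
theorem sum_mul_aeval_restrictedPart_eq_zero (hM : IsAllSquaresSupport k M)
    {φ : Fin ℓ → Fin n} (hφ : Function.Injective φ)
    (hrange : ∀ i, i ∈ Set.range φ ↔ i ∉ isolatedVars M) {f : Fin n → MvPolynomial (Fin n) K}
    (hf : ∀ i, (f i).support ⊆ M) {x : Fin n → K}
    (hx : (isolatedSquareMatrix M f).transpose.mulVec x = 0)
    {a : Fin n → AlgebraicClosure K} (ha : a ∈ solutionSet f) :
    ∑ q, algebraMap K (AlgebraicClosure K) (x q) *
      aeval (fun i => a (φ i)) (restrictedPart φ (f q)) = 0 := by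
  set ψ := algebraMap K (AlgebraicClosure K) with hψ
  have h1 : ∀ q, aeval (fun i => a (φ i)) (restrictedPart φ (f q)) =
      - ∑ i : isolatedVars M, ψ (coeff (Finsupp.single (i : Fin n) 2) (f q)) * a i ^ 2 := fun q =>
    eq_neg_of_add_eq_zero_left
      ((aeval_eq_restrictedPart_add hM hφ hrange (hf q) a).symm.trans (ha q))
  simp only [h1, mul_neg, Finset.sum_neg_distrib, Finset.mul_sum]
  rw [Finset.sum_comm, neg_eq_zero]
  refine Finset.sum_eq_zero fun i _ => ?_
  have h2 : ∑ q, coeff (Finsupp.single (i : Fin n) 2) (f q) * x q = 0 := congrFun hx i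
  have h3 := congrArg ψ h2
  rw [map_zero, map_sum] at h3
  rw [← zero_mul (a i ^ 2), ← h3, Finset.sum_mul]
  refine Finset.sum_congr rfl fun q _ => ?_
  rw [map_mul]; ring

theorem aeval_boxPoly_sum_mul {L : Type*} [Field L] [Algebra K L] (φ : Fin ℓ → Fin n)
    (f : Fin n → MvPolynomial (Fin n) K) (x : Fin n → K) (b : Fin ℓ → L) :
    aeval b (boxPoly fun α => ∑ q, x q * coeff (liftExponent φ α) (f q)) =
      ∑ q, algebraMap K L (x q) * aeval b (restrictedPart φ (f q)) := by
  have : (boxPoly fun α => ∑ q, x q * coeff (liftExponent φ α) (f q)) =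
      ∑ q, x q • restrictedPart φ (f q) := by
    simp only [restrictedPart, boxPoly, Finset.smul_sum, smul_monomial, smul_eq_mul, map_sum]
    rw [Finset.sum_comm]
  rw [this, map_sum]
  exact Finset.sum_congr rfl fun q _ => by rw [map_smul, Algebra.smul_def]

end Elimination

/-! ### The algorithm -/

theorem mainTheorem5 (k : ℕ) (ω c : ℝ) (hω : 2 < ω) :
    ∃ C : ℝ, ∀ (K : Type u) [Field K], MatMulCostBound K ω c →
      ∀ n : ℕ, 2 * k < n →
      ∀ M : Finset (Fin n →₀ ℕ), IsAllSquaresSupport k M →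
      ∀ μ ∈ M, IsSquareFreeMonomial μ →
      ∃ (d : ℕ) (p : ArithProgram K (Fin n × M) (Fin d)),
        ∀ f : Fin n → MvPolynomial (Fin n) K,
          (∀ i, (f i).support ⊆ M) →
          (isolatedSquareMatrix M f).rank = (isolatedVars M).card →
          (solutionSet f).Finite →
          ∃ (y : Fin d → K) (t : ℕ),
            p.exec (fun ij => (f ij.1).coeff ij.2) = some (y, t) ∧
            (t : ℝ) ≤ C * (n : ℝ) ^ ω ∧
            VanishesOnSolutions f μ (polyOfCoeffs y) := by
  classical
  obtain ⟨C₁, hC₁, h₁⟩ := exists_fragment_kernelBasis.{u} ω c hω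
  choose C₂ d hC₂ h₂ using fun ℓ => exists_fragment_eliminant.{u} ω c hω ℓ
  refine ⟨C₁ + ∑ ℓ ∈ Finset.range (2 * k + 1), ((ℓ * 3 ^ ℓ : ℕ) * 2 + C₂ ℓ), ?_⟩
  intro K _ hmul n hn M hM μ hμ hsq
  have hℓ := hM.card_compl_isolatedVars_le
  obtain ⟨ℓ, hℓ'⟩ : ∃ ℓ, (isolatedVars M)ᶜ.card = ℓ := ⟨_, rfl⟩
  rw [hℓ'] at hℓ
  let φ : Fin ℓ → Fin n := (isolatedVars M)ᶜ.orderEmbOfFin hℓ'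
  have hφ : Function.Injective φ := ((isolatedVars M)ᶜ.orderEmbOfFin hℓ').injective
  have hrange : ∀ i, i ∈ Set.range φ ↔ i ∉ isolatedVars M := fun i => by
    rw [Finset.range_orderEmbOfFin, Finset.mem_coe, Finset.mem_compl]
  -- the coefficients of the system; those outside `M` are zero
  let A : Fin n → (Fin n →₀ ℕ) → Operand K (Fin n × M) := fun q α =>
    if h : α ∈ M then .input (q, ⟨α, h⟩) else .const 0
  obtain ⟨F₁, hF₁⟩ := h₁ K hmul (Fin n × M) (Fin (d ℓ)) (isolatedVars M) (Fin n) n (by omega)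
    ((Fintype.card_subtype_le _).trans (Fintype.card_fin n).le) (Fintype.card_fin n).le
  choose F₂ hF₂ using h₂ ℓ K hmul (Fin n × M) (Fin (d ℓ))
  let v₀ : (Fin ℓ → Fin 3) → K := fun α =>
    MvPolynomial.coeff (liftExponent φ α) (MvPolynomial.monomial μ (1 : K))
  -- The left kernel of `S` is computed first. The other branch of the case distinction is only
  -- reached on inputs for which `S` does not have full rank.
  refine ⟨d ℓ, Fragment.toProgram <|
    (F₁ fun i q => A q (Finsupp.single (i : Fin n) 2)).bind fun B =>
      if h : B.1.card = ℓ then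
        (Fragment.traverse fun e : Fin ℓ × (Fin ℓ → Fin 3) =>
          Fragment.innerProduct (fun q => B.2 (B.1.orderEmbOfFin h e.1) q)
            fun q => A q (liftExponent φ e.2)).bind fun V =>
          F₂ fun o α => o.elim (.const (v₀ α)) fun j => V (j, α)
      else .ret fun _ => .const 0, ?_⟩
  intro f hf hrank hfin
  obtain ⟨x, hx⟩ : ∃ x : Fin n × M → K, x = fun ij => (f ij.1).coeff ij.2 := ⟨_, rfl⟩
  rw [← hx]
  refine Fragment.Runs.exec_toProgram ?_
  have hA : ∀ (σ : MachineState K) q α, (A q α).Represents x σ ((f q).coeff α) := by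
    intro σ q α
    by_cases h : α ∈ M
    · simp only [A, dif_pos h]
      have : (f q).coeff α = x (q, ⟨α, h⟩) := by rw [hx]
      rw [this]
      exact Operand.represents_input _
    · simp only [A, dif_neg h]
      rw [MvPolynomial.notMem_support_iff.1 fun h' => h (hf q h')]
      exact Operand.represents_const 0
  refine Fragment.Runs.mono (Fragment.Runs.bind (hF₁ x _ _
    (isolatedSquareMatrix M f).transpose fun i q => hA _ q _) fun B σ₁ _ hB => ?_)
    (t₂ := _) (t₁ := C₁ * (n : ℝ) ^ ω + ((ℓ * 3 ^ ℓ : ℕ) * (2 * n) + C₂ ℓ)) ?_ fun _ _ _ h => h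
  · obtain ⟨N, hN, hbasis⟩ := hB
    have hcard : B.1.card = ℓ := by
      have h1 := hbasis.card_add_rank
      rw [Matrix.rank_transpose, hrank, Fintype.card_fin] at h1
      rw [← hℓ', Finset.card_compl, Fintype.card_fin]
      omega
    rw [dif_pos hcard]
    -- the coefficients of the reduced system, and of `μ`, in the variables `φ i`
    let row : Fin ℓ → Fin n := B.1.orderEmbOfFin hcard
    let v : Option (Fin ℓ) → (Fin ℓ → Fin 3) → K := fun o α =>
      o.elim (v₀ α) fun j => ∑ q, N (row j) q * MvPolynomial.coeff (liftExponent φ α) (f q)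
    have hv : ∀ (j : Fin ℓ) (b : Fin ℓ → AlgebraicClosure K),
        MvPolynomial.aeval b (boxPoly (v (some j))) =
          ∑ q, algebraMap K (AlgebraicClosure K) (N (row j) q) *
            MvPolynomial.aeval b (restrictedPart φ (f q)) := fun j b =>
      aeval_boxPoly_sum_mul φ f (N (row j)) b
    have hsol : ∀ a ∈ solutionSet f, ∀ j,
        MvPolynomial.aeval (fun i => a (φ i)) (boxPoly (v (some j))) = 0 := fun a ha j => by
      rw [hv]
      exact sum_mul_aeval_restrictedPart_eq_zero hM hφ hrange hf
        (hbasis.mulVec_eq_zero _ (B.1.orderEmbOfFin_mem hcard j)) ha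
    have hinner : ∀ (e : Fin ℓ × (Fin ℓ → Fin 3)) σ', σ₁.Extends σ' →
        Fragment.Runs x (Fragment.innerProduct (fun q => B.2 (row e.1) q)
          (fun q => A q (liftExponent φ e.2)) : Fragment K (Fin n × M) (Fin (d ℓ)) _) σ' (2 * n)
          fun r σ' => Operand.Represents x σ' r (v (some e.1) e.2) := fun e σ' hσ' =>
      Fragment.runs_innerProduct (va := fun q => N (row e.1) q)
        (vb := fun q => MvPolynomial.coeff (liftExponent φ e.2) (f q))
        (fun q => (hN _ q).mono hσ') fun q => hA _ q _
    have htrav := Fragment.runs_traverse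
      (fun e r σ₁ σ₂ h (hr : Operand.Represents x σ₁ r (v (some e.1) e.2)) => hr.mono h) hinner
    have hcount : Fintype.card (Fin ℓ × (Fin ℓ → Fin 3)) = ℓ * 3 ^ ℓ := by simp
    rw [hcount] at htrav
    refine Fragment.Runs.bind htrav fun V σ₂ _ hV => ?_
    refine (hF₂ _ x σ₂ v ?_ ?_).mono le_rfl ?_
    · rintro (_ | j) α
      · exact Operand.represents_const _
      · exact hV (j, α)
    · -- the zeros of the reduced system are the restrictions of the solutions
      refine (hfin.image fun a i => a (φ i)).subset fun b hb => ?_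
      obtain ⟨a, ha, hab⟩ := exists_mem_solutionSet_of_isKernelBasis hM hφ hrange hf hrank hbasis b
        fun p hp => by
          obtain ⟨j, rfl⟩ : p ∈ Set.range row := by
            rw [Finset.range_orderEmbOfFin]; exact hp
          rw [← hv]; exact hb j
      exact ⟨a, ha, hab⟩
    · rintro o σ₃ _ ⟨y, hy, hne, hvan⟩
      refine ⟨y, ⟨hne, fun a ha => ?_⟩, hy⟩
      have hmon : MvPolynomial.aeval (fun i => a (φ i)) (boxPoly (v none)) = ∏ i, a i ^ μ i := by
        have h1 := aeval_eq_restrictedPart_add hM hφ hrange (K := K)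
          (f := MvPolynomial.monomial μ 1)
          (fun α hα => by
            rw [Finset.mem_singleton.1 (MvPolynomial.support_monomial_subset hα)]; exact hμ) a
        rw [Finset.sum_eq_zero, add_zero, MvPolynomial.aeval_monomial, map_one, one_mul,
          Finsupp.prod_fintype _ _ fun i => pow_zero _] at h1
        · exact h1.symm
        · intro i _
          rw [MvPolynomial.coeff_monomial, if_neg, map_zero, zero_mul]
          intro h
          have := hsq i
          rw [h, Finsupp.single_eq_same] at this
          omega
      rw [← hmon]
      exact hvan _ (hsol a ha)
  · have hn1 : (1 : ℝ) ≤ n := by exact_mod_cast (by omega : 1 ≤ n)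
    have hnω : (n : ℝ) ≤ (n : ℝ) ^ ω := by
      conv_lhs => rw [← Real.rpow_one (n : ℝ)]
      exact Real.rpow_le_rpow_of_exponent_le hn1 (by linarith)
    have h1 : ((ℓ * 3 ^ ℓ : ℕ) : ℝ) * 2 + C₂ ℓ ≤
        ∑ ℓ ∈ Finset.range (2 * k + 1), (((ℓ * 3 ^ ℓ : ℕ) : ℝ) * 2 + C₂ ℓ) :=
      Finset.single_le_sum (f := fun ℓ => ((ℓ * 3 ^ ℓ : ℕ) : ℝ) * 2 + C₂ ℓ)
        (fun ℓ _ => add_nonneg (by positivity) (hC₂ ℓ)) (Finset.mem_range.2 (by omega))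
    have h2 : ((ℓ * 3 ^ ℓ : ℕ) : ℝ) * (2 * n) + C₂ ℓ ≤
        (((ℓ * 3 ^ ℓ : ℕ) : ℝ) * 2 + C₂ ℓ) * (n : ℝ) ^ ω := by
      have h3 : ((ℓ * 3 ^ ℓ : ℕ) : ℝ) * 2 * n ≤ ((ℓ * 3 ^ ℓ : ℕ) : ℝ) * 2 * (n : ℝ) ^ ω :=
        mul_le_mul_of_nonneg_left hnω (by positivity)
      have h4 : C₂ ℓ ≤ C₂ ℓ * (n : ℝ) ^ ω := le_mul_of_one_le_right (hC₂ ℓ) (hn1.trans hnω)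
      linarith
    have h5 := mul_le_mul_of_nonneg_right h1 (by positivity : (0 : ℝ) ≤ (n : ℝ) ^ ω)
    rw [add_mul]
    linarith
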